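/- Let $N\ge 2$, $R>0$, and let $B_R$ be the open ball of centre $0$ and radius $R$ in $\mathbb{R}^N$. Let $g:\mathbb{R}\to\mathbb{R}$ and suppose that for some $a>0$ the function $g$ is positive and convex on $[a,\infty)$ and satisfies the Keller--Osserman condition $$\int_a^{\infty}\frac{dt}{\sqrt{G(t)}}<\infty,\qquad G(t)=\int_a^t g(s)\,ds .$$ Let $u\in C^2(B_R)$ be a large solution of $-\Delta u+g(u)=0$ in $B_R$, that is, a classical solution of this equation in $B_R$ such that $u(x)\to+\infty$ uniformly as $|x|\to R$. Write $\frac{\partial u}{\partial r}(x)=\langle Du(x),x/|x|\rangle$ for the radial derivative and $\nabla_\tau u(x)=Du(x)-|x|^{-1}\frac{\partial u}{\partial r}(x)\,x$ for the tangential gradient of $u$ at $x\neq 0$. Then $$\text{(i)}\quad \lim_{|x|\to R}\nabla_\tau u(x)=0,\qquad\qquad \text{(ii)}\quad \lim_{|x|\to R}\frac{\partial u}{\partial r}(x)=+\infty,$$ and both limits are uniform with respect to $x\in\{|x|=r\}$ as $r\to R$. -/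

import Mathlib

open Filter Topology

/-- The filter of points `x` with `|x| → R` from inside the ball `B_R`. Its basic sets are the whole
spherical shells `{x | ρ < |x| < R}` with `ρ < R`, so that a limit along it is by definition
uniform with respect to the points of the spheres `{x | |x| = r}` as `r → R`. -/
noncomputable def nearSphere (N : ℕ) (R : ℝ) : Filter (EuclideanSpace ℝ (Fin N)) :=
  comap (fun x => ‖x‖) (𝓝[<] R)

/-- `∂u/∂r (x) = ⟨Du(x), x/|x|⟩`. -/
noncomputable def radialDeriv {N : ℕ} (u : EuclideanSpace ℝ (Fin N) → ℝ)
    (x : EuclideanSpace ℝ (Fin N)) : ℝ :=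
  inner ℝ (gradient u x) (‖x‖⁻¹ • x)

/-- `∇_τ u(x) = Du(x) - |x|⁻¹ (∂u/∂r)(x) x`. -/
noncomputable def tangentialGradient {N : ℕ} (u : EuclideanSpace ℝ (Fin N) → ℝ)
    (x : EuclideanSpace ℝ (Fin N)) : EuclideanSpace ℝ (Fin N) :=
  gradient u x - (‖x‖⁻¹ * radialDeriv u x) • x

/-- The Keller-Osserman condition `∫_a^∞ dt / √G(t) < ∞` with `G(t) = ∫_a^t g(s) ds`. -/
def KellerOsserman (g : ℝ → ℝ) (a : ℝ) : Prop :=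
  MeasureTheory.IntegrableOn (fun t => 1 / Real.sqrt (∫ s in a..t, g s)) (Set.Ioi a)

/-- `u` is a large solution of `-Δu + g(u) = 0` in the ball `B_R`: it is of class `C²` there, solves
the equation in the classical sense, and tends to infinity uniformly as `|x| → R`. -/
structure IsLargeSolution {N : ℕ} (g : ℝ → ℝ) (R : ℝ)
    (u : EuclideanSpace ℝ (Fin N) → ℝ) : Prop where
  contDiffOn : ContDiffOn ℝ 2 u (Metric.ball 0 R)
  equation : ∀ x ∈ Metric.ball (0 : EuclideanSpace ℝ (Fin N)) R,
    -(Laplacian.laplacian u) x + g (u x) = 0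
  blowUp : Tendsto u (nearSphere N R) atTop

/-!
The idea is to show that, near the sphere, second derivatives of `u` along great circles are bounded
above by a multiple of `R² - |x|²`. Both limits follow from this one-sided bound.

* A function on a great circle is periodic, so an upper bound `K` for its second derivative bounds its
  first derivative by `2πK` (`deriv_le_of_periodic`). As `K → 0` at the sphere, the tangential gradient
  tends to `0`.
* On a ray, the equation reads `u_rr + (N - 1) / r * u_r + r⁻² Δ_σ u = g(u)`, and the bound says that
  the spherical Laplacian `Δ_σ u` is small from above, so that `(r^(N-1) u_r)' ≥ 0` near the sphere.
  Since `r^(N-1) u_r` is monotone and `u → ∞`, the mean value theorem forces `u_r → ∞`, uniformly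
  (`IsShellSolution.exists_le_fderiv_radial`).

To get the bound, let `p` be the mean of the rotations of `u` by the angles `h` and `-h` in some plane.
By convexity of `g`, `p` is a subsolution. For `ε > 0` the function
`u + ε (u - b) + (A + ε g(b)) (R² - |x|²)` is, again by convexity, a supersolution. If any two values of
`u` on the same sphere have ratio tending to `1`, it dominates `p` near the sphere, and comparison in a
shell gives `p - u ≤ A (R² - |x|²)` as `ε → 0`, where `A = O(h²)` is determined by the inner sphere
(`IsShellSolution.secondDifference_le`). Dividing by `h²` gives the second derivative.

The asymptotic equivalence comes from explicit radial barriers. The one-dimensional profile `φ`,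
`φ'' = g(φ)`, `φ(0+) = ∞`, exists by the Keller–Osserman condition (`RegularTail.exists_profile`). As a
function of the distance `R - r` it is a subsolution, and `b + exp(c (R - r)) (φ - b)` is a supersolution
up to a bounded error, if `c` is large: the first derivative of the exponential factor produces
`- 2 c √(2 G(φ))`, which outweighs the curvature term, because `√(G(t)) / t → ∞`. The bounded
errors are absorbed by multiples of `R² - r²`, whose Laplacian is `-2N`. The ratio of the barriers tends
to `1`.

Comparison with a radial function needs no Laplacian of radial functions: at an interior maximum of
`U - ψ(|x|)` one tests along the ray, and along the great circles on which `ψ(|x|)` is constant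
(`laplacian_le_of_isLocalMax_sub_radial`).
-/

namespace LargeSolution

open scoped RealInnerProductSpace

/-! ### Second derivatives of functions of one variable -/

theorem secondDeriv_nonpos_of_isLocalMax {f f' : ℝ → ℝ} {x c : ℝ}
    (hf : ∀ᶠ y in 𝓝 x, HasDerivAt f (f' y) y) (hf' : HasDerivAt f' c x) (h : IsLocalMax f x) :
    c ≤ 0 := by
  by_contra! hc
  have e1 : deriv f =ᶠ[𝓝 x] f' := hf.mono fun y hy => hy.deriv
  have e2 : deriv (deriv f) x = c := by rw [e1.deriv_eq, hf'.deriv]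
  have hmin : IsLocalMin f x :=
    isLocalMin_of_deriv_deriv_pos (by rw [e2]; exact hc) h.deriv_eq_zero
      hf.self_of_nhds.continuousAt
  -- A point that is both a local maximum and a local minimum has `f` locally constant around it.
  have e3 : f =ᶠ[𝓝 x] fun _ => f x := by
    filter_upwards [h, hmin] with y h1 h2 using le_antisymm h1 h2
  have e4 : deriv f =ᶠ[𝓝 x] fun _ => (0 : ℝ) := by
    have := e3.deriv
    simpa using this
  have e5 : deriv (deriv f) x = 0 := by rw [e4.deriv_eq]; simp
  linarith

theorem secondDifference_le {f f' f'' : ℝ → ℝ} {C : ℝ}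
    (hf : ∀ s, HasDerivAt f (f' s) s) (hf' : ∀ s, HasDerivAt f' (f'' s) s)
    (hC : ∀ s, f'' s ≤ C) (h : ℝ) : f h + f (-h) - 2 * f 0 ≤ C * h ^ 2 := by
  have hd : ∀ s, HasDerivAt (fun s => f s - C / 2 * s ^ 2) (f' s - C * s) s := fun s => by
    have := (hf s).sub (((hasDerivAt_id s).pow 2).const_mul (C / 2))
    exact this.congr_deriv (by simp; ring)
  have hd' : ∀ s, HasDerivAt (fun s => f' s - C * s) (f'' s - C) s := fun s => by
    have := (hf' s).sub ((hasDerivAt_id s).const_mul C)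
    exact this.congr_deriv (by simp)
  have e1 : deriv (fun s => f s - C / 2 * s ^ 2) = fun s => f' s - C * s :=
    funext fun s => (hd s).deriv
  have hc : ConcaveOn ℝ Set.univ (fun s => f s - C / 2 * s ^ 2) := by
    apply concaveOn_univ_of_deriv2_nonpos (fun s => (hd s).differentiableAt)
    · rw [e1]; exact fun s => (hd' s).differentiableAt
    · intro s
      simp only [Function.iterate_succ, Function.iterate_zero, Function.comp_apply, id]
      rw [e1, (hd' s).deriv]
      linarith [hC s]
  have hc2 := hc.2
  have := hc2 (Set.mem_univ h) (Set.mem_univ (-h)) (a := (1 / 2 : ℝ)) (b := (1 / 2 : ℝ))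
    (by norm_num) (by norm_num) (by norm_num)
  simp only [smul_eq_mul] at this
  ring_nf at this ⊢
  linarith

theorem secondDeriv_le_of_secondDifference_le {f f' : ℝ → ℝ} {K c : ℝ}
    (hf : ∀ᶠ s in 𝓝 0, HasDerivAt f (f' s) s) (hf' : HasDerivAt f' c 0)
    (hK : ∀ h, f h + f (-h) - 2 * f 0 ≤ K * h ^ 2) : c ≤ K := by
  have hneg : Tendsto (fun s : ℝ => -s) (𝓝 0) (𝓝 0) := by
    simpa using (continuous_neg (G := ℝ)).tendsto 0
  have h1 : ∀ᶠ s in 𝓝 (0 : ℝ), HasDerivAt (fun s => f s + f (-s) - K * s ^ 2)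
      (f' s - f' (-s) - 2 * K * s) s := by
    filter_upwards [hf, hneg.eventually hf] with s hs hs'
    have h2 : HasDerivAt (fun s => f (-s)) (f' (-s) * -1) s := hs'.comp s (hasDerivAt_neg s)
    have := (hs.add h2).sub (((hasDerivAt_id s).pow 2).const_mul K)
    exact this.congr_deriv (by simp; ring)
  have h2 : HasDerivAt (fun s => f' s - f' (-s) - 2 * K * s) (2 * c - 2 * K) 0 := by
    have h3 : HasDerivAt (fun s => f' (-s)) (c * -1) 0 := by
      apply HasDerivAt.comp (0 : ℝ) (by simpa using hf') (hasDerivAt_neg 0)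
    have := (hf'.sub h3).sub ((hasDerivAt_id (0 : ℝ)).const_mul (2 * K))
    exact this.congr_deriv (by ring)
  have h3 : IsLocalMax (fun s => f s + f (-s) - K * s ^ 2) 0 := by
    refine Eventually.of_forall fun h => ?_
    have := hK h
    simp only [neg_zero]
    nlinarith
  have := secondDeriv_nonpos_of_isLocalMax h1 h2 h3
  linarith

/-- By Rolle's theorem `f'` vanishes somewhere in the period before `0`; from there it climbs by at most
`K` times the period. -/
theorem deriv_le_of_periodic {f f' f'' : ℝ → ℝ} {K T : ℝ} (hT : 0 < T)
    (hf : ∀ s, HasDerivAt f (f' s) s) (hf' : ∀ s, HasDerivAt f' (f'' s) s)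
    (hK : ∀ s, f'' s ≤ K) (hK0 : 0 ≤ K) (hper : f (-T) = f 0) : f' 0 ≤ K * T := by
  obtain ⟨z, hz, hz0⟩ := exists_hasDerivAt_eq_zero (f := f) (f' := f') (a := -T) (b := 0)
    (by linarith) (fun s _ => (hf s).continuousAt.continuousWithinAt) hper (fun s _ => hf s)
  obtain ⟨ξ, -, hξ⟩ := exists_hasDerivAt_eq_slope f' f'' hz.2
    (fun s _ => (hf' s).continuousAt.continuousWithinAt) (fun s _ => hf' s)
  have h1 : 0 < 0 - z := by linarith [hz.2]
  rw [eq_div_iff h1.ne', hz0] at hξ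
  have := hK ξ
  nlinarith [hz.1, hz.2]

/-! ### Second derivatives along curves, and the Laplacian at a point -/

section Curves

variable {E : Type*} [NormedAddCommGroup E] [InnerProductSpace ℝ E]

theorem hasDerivAt_comp_curve {u : E → ℝ} {γ : ℝ → E} {v : E} {s : ℝ}
    (hu : ContDiffAt ℝ 2 u (γ s)) (hγ : HasDerivAt γ v s) :
    HasDerivAt (fun s => u (γ s)) (fderiv ℝ u (γ s) v) s :=
  (hu.differentiableAt (by norm_num)).hasFDerivAt.comp_hasDerivAt s hγ

theorem hasDerivAt_fderiv_comp_curve {u : E → ℝ} {γ γ' : ℝ → E} {w : E} {s : ℝ}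
    (hu : ContDiffAt ℝ 2 u (γ s)) (hγ : HasDerivAt γ (γ' s) s) (hγ' : HasDerivAt γ' w s) :
    HasDerivAt (fun s => fderiv ℝ u (γ s) (γ' s))
      (fderiv ℝ (fderiv ℝ u) (γ s) (γ' s) (γ' s) + fderiv ℝ u (γ s) w) s := by
  have h1 : DifferentiableAt ℝ (fderiv ℝ u) (γ s) :=
    (hu.fderiv_right (m := 1) (by norm_num)).differentiableAt (by norm_num)
  exact (h1.hasFDerivAt.comp_hasDerivAt s hγ).clm_apply hγ'

theorem hasDerivAt_ellipse (w v₁ v₂ : E) (s : ℝ) :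
    HasDerivAt (fun s => w + (Real.cos s • v₁ + Real.sin s • v₂))
      ((-Real.sin s) • v₁ + Real.cos s • v₂) s :=
  (((Real.hasDerivAt_cos s).smul_const v₁).add ((Real.hasDerivAt_sin s).smul_const v₂)).const_add w

theorem hasDerivAt_ellipse' (v₁ v₂ : E) (s : ℝ) :
    HasDerivAt (fun s => (-Real.sin s) • v₁ + Real.cos s • v₂)
      (-(Real.cos s • v₁ + Real.sin s • v₂)) s := by
  have := (((Real.hasDerivAt_sin s).neg.smul_const v₁).add
    ((Real.hasDerivAt_cos s).smul_const v₂))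
  exact this.congr_deriv (by rw [neg_smul, neg_smul, neg_add])

theorem norm_cos_smul_add_sin_smul {e f : E} (he : ‖e‖ = 1) (hf : ‖f‖ = 1) (hef : ⟪e, f⟫ = 0)
    (s : ℝ) : ‖Real.cos s • e + Real.sin s • f‖ = 1 := by
  have h : ‖Real.cos s • e + Real.sin s • f‖ ^ 2 = 1 := by
    rw [norm_add_sq_real, norm_smul, norm_smul, he, hf, inner_smul_left, inner_smul_right, hef]
    simp
  nlinarith [norm_nonneg (Real.cos s • e + Real.sin s • f)]

variable [FiniteDimensional ℝ E]

theorem laplacian_eq_sum_fderiv (u : E → ℝ) (x : E) {ι : Type*} [Fintype ι]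
    (b : OrthonormalBasis ι ℝ E) :
    Laplacian.laplacian u x = ∑ i, fderiv ℝ (fderiv ℝ u) x (b i) (b i) := by
  rw [InnerProductSpace.laplacian_eq_iteratedFDeriv_orthonormalBasis u b]
  simp [iteratedFDeriv_two_apply]

theorem exists_orthonormalBasis_apply_eq {e : E} (he : ‖e‖ = 1) :
    ∃ (b : OrthonormalBasis (Fin (Module.finrank ℝ E)) ℝ E) (i : Fin (Module.finrank ℝ E)),
      b i = e := by
  have hpos : 0 < Module.finrank ℝ E := by
    rw [Module.finrank_pos_iff_exists_ne_zero]
    exact ⟨e, by rintro rfl; simp at he⟩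
  let i : Fin (Module.finrank ℝ E) := ⟨0, hpos⟩
  obtain ⟨b, hb⟩ := Orthonormal.exists_orthonormalBasis_extension_of_card_eq (𝕜 := ℝ) (E := E)
    (ι := Fin (Module.finrank ℝ E)) (by simp) (v := fun _ => e) (s := {i})
    (by
      constructor
      · intro j; simpa using he
      · rintro ⟨j, hj⟩ ⟨k, hk⟩ hjk
        exact absurd (Subtype.ext ((Set.mem_singleton_iff.1 hj).trans
          (Set.mem_singleton_iff.1 hk).symm)) hjk)
  exact ⟨b, i, hb i rfl⟩

theorem laplacian_le_of_frame {u : E → ℝ} {x e : E} {A B : ℝ} (he : ‖e‖ = 1)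
    (hA : fderiv ℝ (fderiv ℝ u) x e e ≤ A)
    (hB : ∀ f : E, ‖f‖ = 1 → ⟪e, f⟫ = 0 → fderiv ℝ (fderiv ℝ u) x f f ≤ B) :
    Laplacian.laplacian u x ≤ A + ((Module.finrank ℝ E : ℝ) - 1) * B := by
  obtain ⟨b, i, rfl⟩ := exists_orthonormalBasis_apply_eq he
  rw [laplacian_eq_sum_fderiv u x b, ← Finset.add_sum_erase _ _ (Finset.mem_univ i)]
  refine add_le_add hA ?_
  calc _ ≤ ∑ j ∈ Finset.univ.erase i, B := by
        refine Finset.sum_le_sum fun j hj => hB _ (b.norm_eq_one j) ?_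
        exact b.orthonormal.inner_eq_zero (Finset.ne_of_mem_erase hj).symm
    _ = ((Module.finrank ℝ E : ℝ) - 1) * B := by
        have : 1 ≤ Module.finrank ℝ E := by
          have := i.2
          omega
        rw [Finset.sum_const, Finset.card_erase_of_mem (Finset.mem_univ i), nsmul_eq_mul]
        simp [Nat.cast_sub this]

/-- Testing the maximality along the ray through `x` bounds the radial second derivative of `U` by
`ψ''`; testing it along great circles through `x`, where `ψ ‖·‖` is constant, bounds each of the
others by `ψ' / ‖x‖`. -/
theorem laplacian_le_of_isLocalMax_sub_radial {U : E → ℝ} {ψ ψ' : ℝ → ℝ} {c : ℝ} {x : E}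
    (hx : x ≠ 0) (hU : ContDiffAt ℝ 2 U x)
    (hψ : ∀ᶠ s in 𝓝 ‖x‖, HasDerivAt ψ (ψ' s) s) (hψ' : HasDerivAt ψ' c ‖x‖)
    (hmax : IsLocalMax (fun y => U y - ψ ‖y‖) x) :
    Laplacian.laplacian U x ≤ c + ((Module.finrank ℝ E : ℝ) - 1) / ‖x‖ * ψ' ‖x‖ := by
  obtain ⟨e, r, hr, he, rfl⟩ : ∃ (e : E) (r : ℝ), 0 < r ∧ ‖e‖ = 1 ∧ x = r • e :=
    ⟨‖x‖⁻¹ • x, ‖x‖, norm_pos_iff.2 hx, norm_smul_inv_norm hx, by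
      rw [smul_smul, mul_inv_cancel₀ (norm_ne_zero_iff.2 hx), one_smul]⟩
  have hnorm : ∀ s : ℝ, 0 < s → ‖s • e‖ = s := fun s hs => by
    rw [norm_smul, he, mul_one, Real.norm_of_nonneg hs.le]
  rw [hnorm r hr] at hψ hψ' ⊢
  have hU' : ∀ᶠ y in 𝓝 (r • e), ContDiffAt ℝ 2 U y := hU.eventually (by norm_num)
  have hray : ∀ s : ℝ, HasDerivAt (fun s : ℝ => s • e) e s := fun s => by
    simpa using (hasDerivAt_id s).smul_const e
  have hrayt : Tendsto (fun s : ℝ => s • e) (𝓝 r) (𝓝 (r • e)) := (hray r).continuousAt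
  have hraymax : IsLocalMax (fun s : ℝ => U (s • e) - ψ s) r := by
    filter_upwards [hrayt.eventually hmax, lt_mem_nhds hr] with s hs hs0
    simpa [hnorm s hs0, hnorm r hr] using hs
  have hrad1 : ∀ᶠ s in 𝓝 r, HasDerivAt (fun s : ℝ => U (s • e) - ψ s)
      (fderiv ℝ U (s • e) e - ψ' s) s := by
    filter_upwards [hrayt.eventually hU', hψ] with s h1 h2
    exact (hasDerivAt_comp_curve (γ := fun s : ℝ => s • e) h1 (hray s)).sub h2
  have hrad2 := (hasDerivAt_fderiv_comp_curve (γ := fun s : ℝ => s • e) (γ' := fun _ => e)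
    hU (hray r) (hasDerivAt_const r e)).sub hψ'
  have hd0 : fderiv ℝ U (r • e) e = ψ' r := by
    have := hraymax.hasDerivAt_eq_zero hrad1.self_of_nhds
    linarith
  have hA := secondDeriv_nonpos_of_isLocalMax hrad1 hrad2 hraymax
  simp only [map_zero, add_zero] at hA
  refine (laplacian_le_of_frame he (A := c) (B := ψ' r / r) (by linarith) ?_).trans
    (le_of_eq (by ring))
  intro f hf hef
  set γ : ℝ → E := fun s => 0 + (Real.cos s • (r • e) + Real.sin s • (r • f)) with hγdef
  have hγ0 : γ 0 = r • e := by simp [hγdef]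
  have hγn : ∀ s, ‖γ s‖ = r := fun s => by
    have : γ s = r • (Real.cos s • e + Real.sin s • f) := by
      simp only [hγdef, smul_add, smul_smul, zero_add, mul_comm]
    rw [this, norm_smul, norm_cos_smul_add_sin_smul he hf hef, mul_one, Real.norm_of_nonneg hr.le]
  have hγd := hasDerivAt_ellipse (0 : E) (r • e) (r • f)
  have hγt : Tendsto γ (𝓝 0) (𝓝 (r • e)) := by
    have := (hγd 0).continuousAt.tendsto
    simpa [hγdef] using this
  have hmaxγ : IsLocalMax (fun s => U (γ s)) 0 := by
    filter_upwards [hγt.eventually hmax] with s hs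
    simp only [hγn, hnorm r hr] at hs
    rw [hγ0]
    linarith
  have h1 : ∀ᶠ s in 𝓝 (0 : ℝ), HasDerivAt (fun s => U (γ s))
      (fderiv ℝ U (γ s) ((-Real.sin s) • (r • e) + Real.cos s • (r • f))) s := by
    filter_upwards [hγt.eventually hU'] with s hs
    exact hasDerivAt_comp_curve hs (hγd s)
  have h2 := hasDerivAt_fderiv_comp_curve (u := U) (γ := γ) (by rw [hγ0]; exact hU) (hγd 0)
    (hasDerivAt_ellipse' (r • e) (r • f) 0)
  have h3 := secondDeriv_nonpos_of_isLocalMax h1 h2 hmaxγ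
  rw [hγ0] at h3
  simp [hd0] at h3
  rw [le_div_iff₀ hr]
  nlinarith

end Curves

end LargeSolution

namespace LargeSolution

open scoped RealInnerProductSpace

/-! ### Comparison with radial functions in a spherical shell -/

section Comparison

variable {E : Type*} [NormedAddCommGroup E] [InnerProductSpace ℝ E] [FiniteDimensional ℝ E]

/-- Comparison principle: `hlap` forbids a positive interior maximum of `U - ψ ‖·‖`, and `hin`,
`hout` forbid a positive maximum at, or a supremum approached towards, the two boundary spheres. -/
theorem le_radial_of_laplacian {ρ R : ℝ} (hρ : 0 < ρ) {U : E → ℝ} {ψ ψ' ψ'' : ℝ → ℝ}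
    (hU : ∀ x, ρ ≤ ‖x‖ → ‖x‖ < R → ContDiffAt ℝ 2 U x)
    (hψ : ∀ r, ρ ≤ r → r < R → HasDerivAt ψ (ψ' r) r)
    (hψ' : ∀ r, ρ < r → r < R → HasDerivAt ψ' (ψ'' r) r)
    (hin : ∀ x, ‖x‖ = ρ → U x ≤ ψ ρ)
    (hout : ∀ᶠ r in 𝓝[<] R, ∀ x, ‖x‖ = r → U x ≤ ψ r)
    (hlap : ∀ x, ρ < ‖x‖ → ‖x‖ < R → ψ ‖x‖ < U x →
      ψ'' ‖x‖ + ((Module.finrank ℝ E : ℝ) - 1) / ‖x‖ * ψ' ‖x‖ < Laplacian.laplacian U x) :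
    ∀ x, ρ ≤ ‖x‖ → ‖x‖ < R → U x ≤ ψ ‖x‖ := by
  intro x hx1 hx2
  by_contra! hx
  obtain ⟨ρ₁, hρ₁R, hρ₁⟩ : ∃ ρ₁ < R, ∀ r, ρ₁ < r → r < R → ∀ x : E, ‖x‖ = r → U x ≤ ψ r := by
    obtain ⟨ρ₁, h1, h2⟩ := (mem_nhdsLT_iff_exists_Ioo_subset).1 hout
    exact ⟨ρ₁, h1, fun r h3 h4 => h2 ⟨h3, h4⟩⟩
  set ρ₂ := max ρ₁ ‖x‖
  have hρ₂ : ρ₂ < R := max_lt hρ₁R hx2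
  have hK : IsCompact {y : E | ρ ≤ ‖y‖ ∧ ‖y‖ ≤ ρ₂} := by
    refine (isCompact_closedBall (0 : E) ρ₂).of_isClosed_subset ?_ ?_
    · exact (isClosed_le continuous_const continuous_norm).inter
        (isClosed_le continuous_norm continuous_const)
    · intro y hy
      simpa using hy.2
  have hcont : ContinuousOn (fun y => U y - ψ ‖y‖) {y : E | ρ ≤ ‖y‖ ∧ ‖y‖ ≤ ρ₂} := by
    intro y hy
    have hy2 := hy.2.trans_lt hρ₂
    refine ((hU y hy.1 hy2).continuousAt.sub ?_).continuousWithinAt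
    exact ContinuousAt.comp (f := fun y : E => ‖y‖) (hψ _ hy.1 hy2).continuousAt
      continuous_norm.continuousAt
  obtain ⟨y, hy, hmax⟩ := hK.exists_isMaxOn ⟨x, hx1, le_max_right _ _⟩ hcont
  have hxy : U x - ψ ‖x‖ ≤ U y - ψ ‖y‖ := hmax ⟨hx1, le_max_right _ _⟩
  have hy0 : ψ ‖y‖ < U y := by linarith
  have hyR : ‖y‖ < R := hy.2.trans_lt hρ₂
  have hyρ : ρ < ‖y‖ := by
    refine lt_of_le_of_ne hy.1 fun h => ?_
    have := hin y h.symm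
    rw [h] at this
    linarith
  have hloc : IsLocalMax (fun y => U y - ψ ‖y‖) y := by
    filter_upwards [continuous_norm.continuousAt.eventually (lt_mem_nhds hyρ),
      continuous_norm.continuousAt.eventually (gt_mem_nhds hyR)] with z h1 h2
    rcases le_or_gt ‖z‖ ρ₂ with h3 | h3
    · exact hmax ⟨h1.le, h3⟩
    · have := hρ₁ ‖z‖ ((le_max_left _ _).trans_lt h3) h2 z rfl
      linarith
  have hψev : ∀ᶠ s in 𝓝 ‖y‖, HasDerivAt ψ (ψ' s) s := by
    filter_upwards [lt_mem_nhds hyρ, gt_mem_nhds hyR] with s h1 h2 using hψ s h1.le h2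
  have hy00 : y ≠ 0 := norm_pos_iff.1 (hρ.trans hyρ)
  exact absurd (laplacian_le_of_isLocalMax_sub_radial hy00 (hU y hy.1 hyR) hψev
    (hψ' _ hyρ hyR) hloc) (not_le.2 (hlap y hyρ hyR hy0))

theorem laplacian_comp_linearIsometry (u : E → ℝ) (T : E →ₗᵢ[ℝ] E) (x : E) :
    Laplacian.laplacian (fun y => u (T y)) x = Laplacian.laplacian u (T x) := by
  set T' : E ≃ₗᵢ[ℝ] E := T.toLinearIsometryEquiv rfl
  have hT' : ∀ y, T y = T' y := fun y => rfl
  have h := T'.toContinuousLinearEquiv.iteratedFDerivWithin_comp_right u uniqueDiffOn_univ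
    (x := x) (Set.mem_univ _) 2
  rw [Set.preimage_univ, iteratedFDerivWithin_univ, iteratedFDerivWithin_univ] at h
  rw [InnerProductSpace.laplacian_eq_iteratedFDeriv_orthonormalBasis (fun y => u (T y))
      (stdOrthonormalBasis ℝ E),
    InnerProductSpace.laplacian_eq_iteratedFDeriv_orthonormalBasis u
      ((stdOrthonormalBasis ℝ E).map T')]
  refine Finset.sum_congr rfl fun i _ => ?_
  change iteratedFDeriv ℝ 2 (u ∘ T'.toContinuousLinearEquiv) x _ = _
  rw [h, ContinuousMultilinearMap.compContinuousLinearMap_apply]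
  congr 1
  funext j
  fin_cases j <;> simp

end Comparison

/-! ### Rotations in a plane -/

section Rotation

variable {E : Type*} [NormedAddCommGroup E] [InnerProductSpace ℝ E]

/-- The orthogonal projection to the plane spanned by the orthonormal vectors `e`, `f`. -/
noncomputable def planeProj (e f x : E) : E := ⟪e, x⟫ • e + ⟪f, x⟫ • f

/-- The orthogonal projection to the plane spanned by the orthonormal vectors `e`, `f`, followed by
the quarter turn of that plane which maps `e` to `f`. -/
noncomputable def planeTurn (e f x : E) : E := ⟪e, x⟫ • f - ⟪f, x⟫ • e

/-- The rotation by the angle `s` in the plane spanned by the orthonormal vectors `e`, `f`; it fixes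
the orthogonal complement of that plane. -/
noncomputable def planeRotation {e f : E} (he : ‖e‖ = 1) (hf : ‖f‖ = 1) (hef : ⟪e, f⟫ = 0)
    (s : ℝ) : E →ₗᵢ[ℝ] E where
  toFun x := x - planeProj e f x + (Real.cos s • planeProj e f x + Real.sin s • planeTurn e f x)
  map_add' x y := by
    simp only [planeProj, planeTurn, inner_add_right]
    module
  map_smul' c x := by
    simp only [planeProj, planeTurn, inner_smul_right, RingHom.id_apply]
    module
  norm_map' x := by
    have h0 : ∀ v w : E, ‖v‖ ^ 2 = ‖w‖ ^ 2 → ‖v‖ = ‖w‖ := fun v w h =>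
      (pow_left_inj₀ (norm_nonneg v) (norm_nonneg w) two_ne_zero).1 h
    apply h0
    have h1 : x - planeProj e f x +
        (Real.cos s • planeProj e f x + Real.sin s • planeTurn e f x) =
        x + (((Real.cos s - 1) * ⟪e, x⟫ - Real.sin s * ⟪f, x⟫) • e +
          ((Real.cos s - 1) * ⟪f, x⟫ + Real.sin s * ⟪e, x⟫) • f) := by
      simp only [planeProj, planeTurn]
      module
    change ‖x - planeProj e f x +
        (Real.cos s • planeProj e f x + Real.sin s • planeTurn e f x)‖ ^ 2 = ‖x‖ ^ 2
    rw [h1, norm_add_sq_real, norm_add_sq_real, norm_smul, norm_smul, he, hf, inner_add_right,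
      inner_smul_right, inner_smul_right, inner_smul_left, inner_smul_right, hef,
      real_inner_comm e x, real_inner_comm f x]
    simp only [mul_one, mul_zero, add_zero, Real.norm_eq_abs, sq_abs]
    linear_combination (⟪e, x⟫ ^ 2 + ⟪f, x⟫ ^ 2) * Real.sin_sq_add_cos_sq s

theorem planeRotation_apply {e f : E} (he : ‖e‖ = 1) (hf : ‖f‖ = 1) (hef : ⟪e, f⟫ = 0)
    (s : ℝ) (x : E) : planeRotation he hf hef s x =
      x - planeProj e f x + (Real.cos s • planeProj e f x + Real.sin s • planeTurn e f x) := rfl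

theorem planeRotation_zero_apply {e f : E} (he : ‖e‖ = 1) (hf : ‖f‖ = 1) (hef : ⟪e, f⟫ = 0)
    (x : E) : planeRotation he hf hef 0 x = x := by
  simp [planeRotation_apply]

theorem planeRotation_apply_smul {e f : E} (he : ‖e‖ = 1) (hf : ‖f‖ = 1) (hef : ⟪e, f⟫ = 0)
    (s r : ℝ) : planeRotation he hf hef s (r • e) =
      0 + (Real.cos s • (r • e) + Real.sin s • (r • f)) := by
  have h1 : ⟪f, e⟫ = 0 := by rw [real_inner_comm, hef]
  simp [planeRotation_apply, planeProj, planeTurn, h1, he, smul_comm r]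

theorem norm_planeProj_le {e f : E} (he : ‖e‖ = 1) (hf : ‖f‖ = 1) (x : E) :
    ‖planeProj e f x‖ ≤ 2 * ‖x‖ := by
  refine (norm_add_le _ _).trans ?_
  have h1 := abs_real_inner_le_norm e x
  have h2 := abs_real_inner_le_norm f x
  rw [norm_smul, norm_smul, he, hf, Real.norm_eq_abs, Real.norm_eq_abs]
  rw [he] at h1
  rw [hf] at h2
  linarith

theorem norm_planeTurn_le {e f : E} (he : ‖e‖ = 1) (hf : ‖f‖ = 1) (x : E) :
    ‖planeTurn e f x‖ ≤ 2 * ‖x‖ := by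
  refine (norm_sub_le _ _).trans ?_
  have h1 := abs_real_inner_le_norm e x
  have h2 := abs_real_inner_le_norm f x
  rw [norm_smul, norm_smul, he, hf, Real.norm_eq_abs, Real.norm_eq_abs]
  rw [he] at h1
  rw [hf] at h2
  linarith

/-- On a fixed sphere the second differences of `u` along rotations are quadratic in the angle,
uniformly in the point and in the plane of rotation. -/
theorem exists_rotation_secondDifference_le [FiniteDimensional ℝ E] {u : E → ℝ} {ρ : ℝ}
    (hu : ∀ x, ‖x‖ = ρ → ContDiffAt ℝ 2 u x) :
    ∃ C, 0 ≤ C ∧ ∀ {e f : E} (he : ‖e‖ = 1) (hf : ‖f‖ = 1) (hef : ⟪e, f⟫ = 0) (h : ℝ) (x : E),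
      ‖x‖ = ρ → u (planeRotation he hf hef h x) + u (planeRotation he hf hef (-h) x) - 2 * u x
        ≤ C * h ^ 2 := by
  have hcomp : IsCompact {x : E | ‖x‖ = ρ} := by
    have : {x : E | ‖x‖ = ρ} = Metric.sphere (0 : E) ρ := by ext; simp
    rw [this]
    exact isCompact_sphere _ _
  have hc1 : ∀ x, ‖x‖ = ρ → ContDiffAt ℝ 1 (fderiv ℝ u) x := fun x hx =>
    (hu x hx).fderiv_right (by norm_num)
  obtain ⟨C₁, hC₁⟩ := hcomp.exists_bound_of_continuousOn (f := fderiv ℝ u)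
    fun x hx => (hc1 x hx).continuousAt.continuousWithinAt
  obtain ⟨C₂, hC₂⟩ := hcomp.exists_bound_of_continuousOn (f := fderiv ℝ (fderiv ℝ u))
    fun x hx => ((hc1 x hx).fderiv_right (m := 0) (by norm_num)).continuousAt.continuousWithinAt
  set M : ℝ := 2 * |ρ| + 2 * |ρ|
  refine ⟨|C₂| * M * M + |C₁| * M, by positivity, ?_⟩
  intro e f he hf hef h x hx
  have hγ : ∀ s, ‖planeRotation he hf hef s x‖ = ρ := fun s => by
    rw [LinearIsometry.norm_map, hx]
  have hb : ∀ a b : ℝ, |a| ≤ 1 → |b| ≤ 1 → ‖a • planeProj e f x + b • planeTurn e f x‖ ≤ M := by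
    intro a b ha hb
    refine (norm_add_le _ _).trans ?_
    rw [norm_smul, norm_smul, Real.norm_eq_abs, Real.norm_eq_abs]
    have h1 := norm_planeProj_le he hf x
    have h2 := norm_planeTurn_le he hf x
    rw [hx] at h1 h2
    have h3 := mul_le_mul ha h1 (norm_nonneg _) zero_le_one
    have h4 := mul_le_mul hb h2 (norm_nonneg _) zero_le_one
    simp only [M]
    linarith [le_abs_self ρ]
  have hd := hasDerivAt_ellipse (x - planeProj e f x) (planeProj e f x) (planeTurn e f x)
  have hd' := hasDerivAt_ellipse' (planeProj e f x) (planeTurn e f x)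
  have := secondDifference_le (f := fun s => u (planeRotation he hf hef s x))
    (fun s => hasDerivAt_comp_curve (hu _ (hγ s)) (hd s))
    (fun s => hasDerivAt_fderiv_comp_curve (hu _ (hγ s)) (hd s) (hd' s))
    (C := |C₂| * M * M + |C₁| * M) ?_ h
  · simpa only [planeRotation_zero_apply] using this
  intro s
  have hsin : |-Real.sin s| ≤ 1 := by rw [abs_neg]; exact Real.abs_sin_le_one s
  have hM : 0 ≤ M := (norm_nonneg _).trans (hb 1 1 (by simp) (by simp))
  refine add_le_add ?_ ?_
  · refine (le_abs_self _).trans ?_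
    rw [← Real.norm_eq_abs]
    refine (ContinuousLinearMap.le_opNorm₂ _ _ _).trans ?_
    have h1 := hb _ _ hsin (Real.abs_cos_le_one s)
    have h2 := (hC₂ _ (hγ s)).trans (le_abs_self _)
    gcongr
  · refine (le_abs_self _).trans ?_
    rw [← Real.norm_eq_abs]
    refine (ContinuousLinearMap.le_opNorm _ _).trans ?_
    have h1 := hb _ _ (Real.abs_cos_le_one s) (Real.abs_sin_le_one s)
    have h2 := (hC₁ _ (hγ s)).trans (le_abs_self _)
    rw [norm_neg]
    gcongr

end Rotation

end LargeSolution

namespace LargeSolution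

open MeasureTheory Set

/-! ### The nonlinearity far out and the one-dimensional blow-up profile -/

/-- What the proof uses of the nonlinearity `g` and of a primitive `G` of it on the half line
`[b, ∞)`. The lower bound on `√(2G)` allows any prescribed slope `c`, at the price of a large `b`. -/
structure RegularTail (g G : ℝ → ℝ) (b c : ℝ) : Prop where
  convex : ConvexOn ℝ (Ici b) g
  mono : MonotoneOn g (Ici b)
  pos : ∀ t, b ≤ t → 0 < g t
  hasDerivAt : ∀ t, b ≤ t → HasDerivAt G (g t) t
  primitive_pos : ∀ t, b ≤ t → 0 < G t
  growth : ∀ t, b ≤ t → c * (t - b) ≤ √(2 * G t)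
  integrable : IntegrableOn (fun t => 1 / √(2 * G t)) (Ioi b)

theorem _root_.ConvexOn.monotoneOn_Ici_of_lt {f : ℝ → ℝ} {a x y : ℝ}
    (hf : ConvexOn ℝ (Ici a) f) (hx : a ≤ x) (hxy : x < y) (h : f x < f y) :
    MonotoneOn f (Ici y) := by
  have key : ∀ s t, x < s → s < t → f x < f s → f s < f t := fun s t h1 h2 h3 => by
    have h4 := hf.slope_mono_adjacent (mem_Ici.2 hx) (mem_Ici.2 (by linarith : a ≤ t)) h1 h2
    have h5 : 0 < (f s - f x) / (s - x) := div_pos (by linarith) (by linarith)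
    have h6 := (div_pos_iff_of_pos_right (by linarith : 0 < t - s)).1 (h5.trans_le h4)
    linarith
  intro s hs t ht hst
  rcases hst.eq_or_lt with rfl | hst
  · exact le_rfl
  rcases (mem_Ici.1 hs).eq_or_lt with rfl | hs
  · exact (key _ _ hxy hst h).le
  · exact (key _ _ (hxy.trans hs) hst (h.trans (key _ _ hxy hs h))).le

theorem _root_.ConvexOn.intervalIntegrable_of_pos {g : ℝ → ℝ} {a t : ℝ}
    (hg : ConvexOn ℝ (Ici a) g) (hpos : ∀ s ∈ Ici a, 0 < g s) (hat : a ≤ t) :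
    IntervalIntegrable g volume a t := by
  have hcont : ContinuousOn g (Ioi a) := by
    have := hg.continuousOn_interior
    rwa [interior_Ici] at this
  rw [intervalIntegrable_iff_integrableOn_Ioc_of_le hat]
  refine Integrable.of_bound
    ((hcont.mono Ioc_subset_Ioi_self).aestronglyMeasurable measurableSet_Ioc) (max (g a) (g t)) ?_
  filter_upwards [ae_restrict_mem measurableSet_Ioc] with s hs
  rw [Real.norm_of_nonneg (hpos s (mem_Ici.2 hs.1.le)).le]
  exact hg.le_max_of_mem_Icc self_mem_Ici (mem_Ici.2 hat) ⟨hs.1.le, hs.2⟩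

/-- The Keller–Osserman condition gives `√(G(t)) / t → ∞`. Hence `g` is unbounded, and a convex
function that increases somewhere increases from there on. -/
theorem exists_regularTail {g : ℝ → ℝ} {a : ℝ} (ha : 0 < a) (hpos : ∀ s ∈ Ici a, 0 < g s)
    (hconv : ConvexOn ℝ (Ici a) g) (hKO : KellerOsserman g a) {c : ℝ} (hc : 0 < c) :
    ∃ (G : ℝ → ℝ) (b : ℝ), RegularTail g G b c := by
  set G : ℝ → ℝ := fun t => ∫ s in a..t, g s with hG
  have hcont : ContinuousOn g (Ioi a) := by
    have := hconv.continuousOn_interior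
    rwa [interior_Ici] at this
  have hint : ∀ t, a ≤ t → IntervalIntegrable g volume a t := fun t ht =>
    hconv.intervalIntegrable_of_pos hpos ht
  have hderiv : ∀ t, a < t → HasDerivAt G (g t) t := fun t ht =>
    intervalIntegral.integral_hasDerivAt_right (hint t ht.le)
      (hcont.stronglyMeasurableAtFilter isOpen_Ioi t ht) (hcont.continuousAt (Ioi_mem_nhds ht))
  have hGadd : ∀ s t, a ≤ s → s ≤ t → G t = G s + ∫ r in s..t, g r := fun s t hs hst =>
    (intervalIntegral.integral_add_adjacent_intervals (hint s hs)
      ((hint s hs).symm.trans (hint t (hs.trans hst)))).symm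
  have hGpos : ∀ t, a < t → 0 < G t := fun t ht =>
    intervalIntegral.intervalIntegral_pos_of_pos_on (hint t ht.le)
      (fun s hs => hpos s (mem_Ici.2 hs.1.le)) ht
  have hGmono : ∀ s t, a ≤ s → s ≤ t → G s ≤ G t := fun s t hs hst => by
    rw [hGadd s t hs hst]
    have : 0 ≤ ∫ r in s..t, g r := intervalIntegral.integral_nonneg hst fun r hr =>
      (hpos r (mem_Ici.2 (hs.trans hr.1))).le
    linarith
  have hI : IntegrableOn (fun t => 1 / √(G t)) (Ioi a) := hKO
  -- The integral of `1 / √G` over `[t, 2t]` tends to `0` and is at least `t / √(G (2t))`.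
  have hlim : Tendsto (fun t : ℝ => ∫ s in t..2 * t, 1 / √(G s)) atTop (𝓝 0) := by
    have h1 := intervalIntegral_tendsto_integral_Ioi a hI tendsto_id
    have h2 := intervalIntegral_tendsto_integral_Ioi a hI
      (tendsto_id.const_mul_atTop (two_pos : (0 : ℝ) < 2))
    have h3 := h2.sub h1
    rw [sub_self] at h3
    refine h3.congr' ?_
    filter_upwards [eventually_ge_atTop a] with t ht
    have i1 : ∀ s, a ≤ s → IntervalIntegrable (fun t => 1 / √(G t)) volume a s := fun s hs =>
      (intervalIntegrable_iff_integrableOn_Ioc_of_le hs).2 (hI.mono_set Ioc_subset_Ioi_self)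
    exact intervalIntegral.integral_interval_sub_left (i1 _ (by simp only [id]; linarith)) (i1 _ ht)
  have hgrow : ∀ K : ℝ, 0 < K → ∀ᶠ t in atTop, K * t ≤ √(G t) := by
    intro K hK
    have h1 : ∀ᶠ t : ℝ in atTop, 2 * K * t ≤ √(G (2 * t)) := by
      filter_upwards [hlim.eventually (gt_mem_nhds (by positivity : 0 < 1 / (2 * K))),
        eventually_gt_atTop a] with t ht hat
      have h2 : ∫ _ in t..2 * t, 1 / √(G (2 * t)) ≤ ∫ s in t..2 * t, 1 / √(G s) := by
        refine intervalIntegral.integral_mono_on (by linarith) (by simp) ?_ fun s hs => ?_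
        · exact (intervalIntegrable_iff_integrableOn_Ioc_of_le (by linarith)).2
            (hI.mono_set fun s hs => hat.trans hs.1)
        · exact one_div_le_one_div_of_le (Real.sqrt_pos.2 (hGpos s (hat.trans_le hs.1)))
            (Real.sqrt_le_sqrt (hGmono _ _ (hat.le.trans hs.1) hs.2))
      rw [intervalIntegral.integral_const, smul_eq_mul] at h2
      have h3 : 0 < √(G (2 * t)) := Real.sqrt_pos.2 (hGpos _ (by linarith))
      have h4 := h2.trans ht.le
      rw [mul_one_div, div_le_div_iff₀ h3 (by positivity)] at h4
      linarith
    have h2 := (tendsto_id.const_mul_atTop (by norm_num : (0 : ℝ) < 1 / 2)).eventually h1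
    filter_upwards [h2] with t ht
    simp only [id] at ht
    have e : 2 * (1 / 2 * t) = t := by ring
    rw [e] at ht
    linarith
  -- A function bounded by `g (a + 1)` would have a primitive of linear growth only.
  obtain ⟨y, hy, hgy⟩ : ∃ y, a + 1 < y ∧ g (a + 1) < g y := by
    by_contra! hle
    have h1 : ∀ t, a + 1 ≤ t → G t ≤ G (a + 1) + g (a + 1) * (t - (a + 1)) := fun t ht => by
      rw [hGadd (a + 1) t (by linarith) ht]
      have h2 : ∫ r in (a + 1)..t, g r ≤ ∫ _ in (a + 1)..t, g (a + 1) := by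
        refine intervalIntegral.integral_mono_on ht
          ((hint _ (by linarith)).symm.trans (hint t (by linarith))) (by simp) fun s hs => ?_
        rcases hs.1.eq_or_lt with h | h
        · rw [← h]
        · exact hle s h
      rw [intervalIntegral.integral_const, smul_eq_mul] at h2
      linarith
    obtain ⟨t, h2, h3, h4, h5⟩ := ((hgrow 1 one_pos).and ((eventually_ge_atTop (a + 1)).and
      ((eventually_ge_atTop (G (a + 1) + 1)).and
        (eventually_gt_atTop (g (a + 1) + 1))))).exists
    have h6 := h1 t h3
    have h7 := Real.sq_sqrt (hGpos t (by linarith)).le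
    have h8 := hpos (a + 1) (mem_Ici.2 (by linarith))
    nlinarith
  have hmono := hconv.monotoneOn_Ici_of_lt (by linarith) hy hgy
  obtain ⟨b₀, hb₀⟩ := eventually_atTop.1 (hgrow c hc)
  refine ⟨G, max y b₀, ?_⟩
  have hyb : ∀ t, max y b₀ ≤ t → y ≤ t ∧ b₀ ≤ t := fun t ht => max_le_iff.1 ht
  have hyb0 : 0 < max y b₀ := lt_of_lt_of_le (by linarith) (le_max_left y b₀)
  refine ⟨hconv.subset (Ici_subset_Ici.2 ?_) (convex_Ici _),
    hmono.mono (Ici_subset_Ici.2 (le_max_left _ _)), fun t ht => hpos t ?_,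
    fun t ht => hderiv t ?_, fun t ht => hGpos t ?_, fun t ht => ?_, ?_⟩
  · exact le_trans (by linarith) (le_max_left y b₀)
  · exact mem_Ici.2 (by linarith [hyb t ht])
  · linarith [hyb t ht]
  · linarith [hyb t ht]
  · have h1 := hb₀ t (hyb t ht).2
    have h2 : √(G t) ≤ √(2 * G t) :=
      Real.sqrt_le_sqrt (by linarith [hGpos t (by linarith [hyb t ht])])
    nlinarith
  · have h1 : IntegrableOn (fun t => 1 / √(G t)) (Ioi (max y b₀)) :=
      hI.mono_set (Ioi_subset_Ioi (le_trans (by linarith) (le_max_left y b₀)))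
    have h2 := h1.const_mul (1 / √2)
    refine h2.congr (Eventually.of_forall fun t => ?_)
    simp only
    rw [Real.sqrt_mul (by norm_num), one_div_mul_one_div]

/-- A one-dimensional blow-up profile: `φ > b` decreases on `(0, T)` from `+∞`, and solves `φ'' = g(φ)`
through its first integral `φ' = -√(2 G(φ))`. -/
structure IsBlowUpProfile (g G : ℝ → ℝ) (b T : ℝ) (φ : ℝ → ℝ) : Prop where
  gt : ∀ t, 0 < t → t < T → b < φ t
  hasDerivAt : ∀ t, 0 < t → t < T → HasDerivAt φ (-√(2 * G (φ t))) t
  hasDerivAt' : ∀ t, 0 < t → t < T → HasDerivAt (fun t => -√(2 * G (φ t))) (g (φ t)) t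
  antitoneOn : AntitoneOn φ (Ioo 0 T)
  tendsto : Tendsto φ (𝓝[>] 0) atTop

/-- The profile is the inverse of `y ↦ ∫_y^∞ dt / √(2 G(t))`, which is finite by the Keller–Osserman
condition. -/
theorem RegularTail.exists_profile {g G : ℝ → ℝ} {b c : ℝ} (h : RegularTail g G b c) :
    ∃ (T : ℝ) (φ : ℝ → ℝ), 0 < T ∧ IsBlowUpProfile g G b T φ := by
  set f : ℝ → ℝ := fun t => 1 / √(2 * G t) with hf
  have hs0 : ∀ t, b ≤ t → 0 < √(2 * G t) := fun t ht =>
    Real.sqrt_pos.2 (by linarith [h.primitive_pos t ht])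
  have hfpos : ∀ t, b ≤ t → 0 < f t := fun t ht => one_div_pos.2 (hs0 t ht)
  have hfc : ∀ t, b ≤ t → ContinuousAt f t := fun t ht =>
    continuousAt_const.div
      ((continuousAt_const.mul (h.hasDerivAt t ht).continuousAt).sqrt) (hs0 t ht).ne'
  set F : ℝ → ℝ := fun y => ∫ t in b..y, f t with hF
  have hfi : ∀ y, b ≤ y → IntervalIntegrable f volume b y := fun y hy =>
    ContinuousOn.intervalIntegrable_of_Icc hy fun t ht => (hfc t ht.1).continuousWithinAt
  have hFd : ∀ y, b < y → HasDerivAt F (f y) y := fun y hy =>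
    intervalIntegral.integral_hasDerivAt_right (hfi y hy.le)
      (ContinuousOn.stronglyMeasurableAtFilter isOpen_Ioi
        (fun t ht => (hfc t (le_of_lt ht)).continuousWithinAt) y (mem_Ioi.2 hy)) (hfc y hy.le)
  have hFc : ∀ Y, ContinuousOn F (Icc b Y) := fun Y => by
    rcases le_or_gt b Y with hY | hY
    · have := intervalIntegral.continuousOn_primitive_interval (f := f) (μ := volume) (a := b)
        (b := Y) (by
          rw [uIcc_of_le hY]
          exact (ContinuousOn.integrableOn_Icc fun t ht => (hfc t ht.1).continuousWithinAt))
      rwa [uIcc_of_le hY] at this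
    · rw [Icc_eq_empty hY.not_ge]
      exact continuousOn_empty F
  have hFmono : StrictMonoOn F (Ici b) := by
    refine strictMonoOn_of_deriv_pos (convex_Ici b) (fun t ht => ?_) fun t ht => ?_
    · exact ((hFc (t + 1)) t ⟨ht, by linarith⟩).mono_of_mem_nhdsWithin
        (by
          rw [← Ici_inter_Iic]
          exact inter_mem_nhdsWithin _ (Iic_mem_nhds (by linarith)))
    · rw [interior_Ici] at ht
      rw [(hFd t ht).deriv]
      exact hfpos t (le_of_lt ht)
  have hF0 : F b = 0 := intervalIntegral.integral_same
  set I : ℝ := ∫ t in Ioi b, f t with hI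
  have hFlim : Tendsto F atTop (𝓝 I) := intervalIntegral_tendsto_integral_Ioi b h.integrable
    tendsto_id
  have hFlt : ∀ y, b ≤ y → F y < I := fun y hy => by
    refine (hFmono hy (mem_Ici.2 (by linarith)) (lt_add_one y)).trans_le ?_
    refine ge_of_tendsto hFlim ?_
    filter_upwards [eventually_ge_atTop (y + 1)] with z hz
    exact hFmono.monotoneOn (mem_Ici.2 (by linarith)) (mem_Ici.2 (by linarith)) hz
  have hIpos : 0 < I := hF0 ▸ hFlt b le_rfl
  have hsurj : ∀ s, 0 < s → s < I → ∃ y ∈ Ioi b, F y = s := fun s h0 h1 => by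
    obtain ⟨Y, hY, hYb⟩ := ((hFlim.eventually (lt_mem_nhds h1)).and (eventually_ge_atTop b)).exists
    obtain ⟨y, hy, hys⟩ := intermediate_value_Icc hYb (hFc Y)
      (show s ∈ Icc (F b) (F Y) from ⟨by rw [hF0]; exact h0.le, hY.le⟩)
    refine ⟨y, lt_of_le_of_ne hy.1 ?_, hys⟩
    rintro rfl
    rw [hF0] at hys
    exact h0.ne hys
  set H : ℝ → ℝ := Function.invFunOn F (Ioi b) with hH
  have hHmem : ∀ s, 0 < s → s < I → b < H s := fun s h0 h1 =>
    Function.invFunOn_mem (hsurj s h0 h1)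
  have hFH : ∀ s, 0 < s → s < I → F (H s) = s := fun s h0 h1 =>
    Function.invFunOn_eq (hsurj s h0 h1)
  have hle : ∀ s y, 0 < s → s < I → b ≤ y → (H s ≤ y ↔ s ≤ F y) := fun s y h0 h1 hy => by
    rw [← hFmono.le_iff_le (mem_Ici.2 (hHmem s h0 h1).le) (mem_Ici.2 hy), hFH s h0 h1]
  have hHF : ∀ y, b < y → H (F y) = y := fun y hy => by
    have h0 : 0 < F y := hF0 ▸ hFmono self_mem_Ici (mem_Ici.2 hy.le) hy
    exact hFmono.injOn (mem_Ici.2 (hHmem _ h0 (hFlt y hy.le)).le) (mem_Ici.2 hy.le)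
      (hFH _ h0 (hFlt y hy.le))
  have hHd : ∀ s, 0 < s → s < I → HasDerivAt H (√(2 * G (H s))) s := fun s h0 h1 => by
    have hcH : ContinuousAt H s := by
      refine continuousAt_of_monotoneOn_of_image_mem_nhds (s := Ioo 0 I) ?_ (Ioo_mem_nhds h0 h1) ?_
      · intro s₁ hs₁ s₂ hs₂ h12
        rw [hle s₁ _ hs₁.1 hs₁.2 (hHmem s₂ hs₂.1 hs₂.2).le, hFH s₂ hs₂.1 hs₂.2]
        exact h12
      · refine mem_of_superset (Ioi_mem_nhds (hHmem s h0 h1)) fun y hy => ?_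
        exact ⟨F y, ⟨hF0 ▸ hFmono self_mem_Ici (mem_Ici.2 (le_of_lt hy)) hy,
          hFlt y (le_of_lt hy)⟩, hHF y hy⟩
    have := HasDerivAt.of_local_left_inverse hcH (hFd _ (hHmem s h0 h1))
      (hfpos _ (hHmem s h0 h1).le).ne' (by
        filter_upwards [Ioo_mem_nhds h0 h1] with y hy using hFH y hy.1 hy.2)
    refine this.congr_deriv ?_
    simp [hf]
  have hφd : ∀ t, 0 < t → t < I → HasDerivAt (fun t => H (I - t)) (-√(2 * G (H (I - t)))) t :=
    fun t h0 h1 => by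
      have := HasDerivAt.comp t (hHd (I - t) (by linarith) (by linarith))
        ((hasDerivAt_id t).const_sub I)
      exact this.congr_deriv (by simp)
  refine ⟨I, fun t => H (I - t), hIpos, fun t h0 h1 => hHmem _ (by linarith) (by linarith), hφd,
    fun t h0 h1 => ?_, fun s hs t ht hst => ?_, ?_⟩
  · have hb := (hHmem (I - t) (by linarith) (by linarith)).le
    have h2 := ((h.hasDerivAt _ hb).comp t (hφd t h0 h1)).const_mul 2
    have h3 := (h2.sqrt (by
      have := h.primitive_pos _ hb
      simp only [Function.comp_apply]
      positivity)).neg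
    refine h3.congr_deriv ?_
    have := (hs0 _ hb).ne'
    simp only [Function.comp_apply]
    field_simp
  · have h1 : 0 < I - s := by linarith [hs.2]
    have h2 : 0 < I - t := by linarith [ht.2]
    rw [hle _ _ h2 (by linarith [ht.1]) (hHmem _ h1 (by linarith [hs.1])).le,
      hFH _ h1 (by linarith [hs.1])]
    linarith
  · rw [tendsto_atTop]
    intro M
    have hpos : 0 < I - F (max M b) := by linarith [hFlt (max M b) (le_max_right _ _)]
    filter_upwards [Ioo_mem_nhdsGT (lt_min hpos hIpos)] with t ht
    have h1 := lt_min_iff.1 ht.2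
    by_contra! hlt
    have h2 := (hle (I - t) (max M b) (by linarith) (by linarith [ht.1]) (le_max_right _ _)).1
      (hlt.le.trans (le_max_left _ _))
    linarith

end LargeSolution

namespace LargeSolution

open Set

/-! ### Radial barriers and the comparison of two large solutions -/

section Barriers

variable {E : Type*} [NormedAddCommGroup E] [InnerProductSpace ℝ E] [FiniteDimensional ℝ E]

/-- A large solution `u ≥ b` of `Δu = g(u)` in the shell `ρ ≤ |x| < R`, blowing up at the outer
sphere only. -/
structure IsShellSolution (g : ℝ → ℝ) (b ρ R : ℝ) (u : E → ℝ) : Prop where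
  contDiffAt : ∀ x, ρ ≤ ‖x‖ → ‖x‖ < R → ContDiffAt ℝ 2 u x
  equation : ∀ x, ρ ≤ ‖x‖ → ‖x‖ < R → Laplacian.laplacian u x = g (u x)
  ge : ∀ x, ρ ≤ ‖x‖ → ‖x‖ < R → b ≤ u x
  blowUp : ∀ M : ℝ, ∀ᶠ r in 𝓝[<] R, ∀ x : E, ‖x‖ = r → M ≤ u x

variable {g G φ : ℝ → ℝ} {b c ρ R T : ℝ} {u : E → ℝ}

/-- Convexity, with `t` between `b` and its dilate `b + X (t - b)`. -/
theorem RegularTail.mul_le (hg : RegularTail g G b c) {t X : ℝ} (ht : b ≤ t) (hX : 1 ≤ X) :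
    X * g t ≤ g (b + X * (t - b)) + (X - 1) * g b := by
  have hX0 : 0 < X := by linarith
  have hconv := hg.convex.2
  have h1 := hconv (x := b) (y := b + X * (t - b)) self_mem_Ici
    (mem_Ici.2 (by nlinarith)) (a := 1 - X⁻¹) (b := X⁻¹)
    (sub_nonneg.2 (inv_le_one_of_one_le₀ hX)) (inv_nonneg.2 hX0.le) (by ring)
  simp only [smul_eq_mul] at h1
  have e : (1 - X⁻¹) * b + X⁻¹ * (b + X * (t - b)) = t := by
    field_simp
    ring
  rw [e] at h1
  have h2 := mul_le_mul_of_nonneg_left h1 hX0.le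
  have e2 : X * ((1 - X⁻¹) * g b + X⁻¹ * g (b + X * (t - b))) =
      (X - 1) * g b + g (b + X * (t - b)) := by
    field_simp
  linarith

/-- The profile stretched by `exp (c t)` is a supersolution up to the error `(exp (c t) - 1) g(b)`:
for `k ≤ c` the curvature term with coefficient `k` is dominated by the term `- 2 c √(2 G)`, which
comes from the first derivative of the exponential factor. -/
theorem RegularTail.stretched_le (hg : RegularTail g G b c) {t X k : ℝ} (ht : b ≤ t) (hX : 1 ≤ X)
    (hc : 0 ≤ c) (hk : k ≤ c) :
    X * (c ^ 2 * (t - b) - 2 * c * √(2 * G t) + g t) - k * (X * (c * (t - b) + -√(2 * G t))) ≤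
      g (b + X * (t - b)) + (X - 1) * g b := by
  have hgr := hg.growth _ ht
  have hs : 0 ≤ √(2 * G t) := Real.sqrt_nonneg _
  have h4 : c ^ 2 * (t - b) - 2 * c * √(2 * G t) + g t - k * (c * (t - b) + -√(2 * G t)) ≤ g t := by
    nlinarith [mul_nonneg (sub_nonneg.2 hk) (sub_nonneg.2 hgr), mul_nonneg hc hs]
  have h5 := mul_le_mul_of_nonneg_left h4 (by linarith : 0 ≤ X)
  have h6 := hg.mul_le ht hX
  linarith

theorem hasDerivAt_comp_const_sub {f : ℝ → ℝ} {f' a r : ℝ} (h : HasDerivAt f f' (a - r)) :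
    HasDerivAt (fun r => f (a - r)) (-f') r := by
  have := HasDerivAt.comp r h ((hasDerivAt_id r).const_sub a)
  exact this.congr_deriv (by simp)

theorem hasDerivAt_const_mul_sq_sub_sq (K R r : ℝ) :
    HasDerivAt (fun r => K * (R ^ 2 - r ^ 2)) (-(2 * K * r)) r := by
  have := (((hasDerivAt_id r).pow 2).const_sub (R ^ 2)).const_mul K
  exact this.congr_deriv (by simp; ring)

theorem hasDerivAt_neg_two_mul (K r : ℝ) :
    HasDerivAt (fun r => -(2 * K * r)) (-(2 * K)) r := by
  have := ((hasDerivAt_id r).const_mul (2 * K)).neg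
  exact this.congr_deriv (by simp)

/-- Lower bound: `r ↦ φ (R + δ - r)` is a subsolution, finite on the sphere of radius `R`; the term
in `R² - r²` brings it below `b` at the inner sphere and keeps it a subsolution. -/
theorem IsShellSolution.exists_profile_le (hu : IsShellSolution g b ρ R u)
    (hg : RegularTail g G b c) (hn : 2 ≤ Module.finrank ℝ E) (hρ : 0 < ρ) (hρR : ρ < R)
    (hT : R - ρ < T) (hφ : IsBlowUpProfile g G b T φ) :
    ∃ K, 0 ≤ K ∧ ∀ x, ρ ≤ ‖x‖ → ‖x‖ < R → φ (R - ‖x‖) - K * (R ^ 2 - ‖x‖ ^ 2) ≤ u x := by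
  have hn' : (2 : ℝ) ≤ Module.finrank ℝ E := by exact_mod_cast hn
  have hη : 0 < R ^ 2 - ρ ^ 2 := by nlinarith
  have hφρ := hφ.gt (R - ρ) (by linarith) hT
  set K := (φ (R - ρ) - b) / (R ^ 2 - ρ ^ 2) with hK
  have hK0 : 0 ≤ K := div_nonneg (by linarith) hη.le
  have hKρ : K * (R ^ 2 - ρ ^ 2) = φ (R - ρ) - b := div_mul_cancel₀ _ hη.ne'
  refine ⟨K, hK0, fun x hx1 hx2 => ?_⟩
  have key : ∀ δ, 0 < δ → δ < T - (R - ρ) →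
      φ (R + δ - ‖x‖) - K * (R ^ 2 - ‖x‖ ^ 2) ≤ u x := by
    intro δ hδ0 hδ1
    have hτ : ∀ r, ρ ≤ r → r < R → 0 < R + δ - r ∧ R + δ - r < T := fun r h1 h2 =>
      ⟨by linarith, by linarith⟩
    have hmain := le_radial_of_laplacian (U := -u) hρ (R := R)
      (ψ := fun r => -φ (R + δ - r) + K * (R ^ 2 - r ^ 2))
      (ψ' := fun r => -√(2 * G (φ (R + δ - r))) + -(2 * K * r))
      (ψ'' := fun r => -g (φ (R + δ - r)) + -(2 * K))
      (fun x h1 h2 => (hu.contDiffAt x h1 h2).neg)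
      (fun r h1 h2 => ?_) (fun r h1 h2 => ?_) (fun x hx => ?_) ?_ (fun x h1 h2 h3 => ?_) x hx1 hx2
    · simp only [Pi.neg_apply] at hmain
      linarith
    · have := hasDerivAt_comp_const_sub (hφ.hasDerivAt _ (hτ r h1 h2).1 (hτ r h1 h2).2)
      exact (this.neg.add (hasDerivAt_const_mul_sq_sub_sq K R r)).congr_deriv (by simp)
    · have := hasDerivAt_comp_const_sub (hφ.hasDerivAt' _ (hτ r h1.le h2).1 (hτ r h1.le h2).2)
      exact this.add (hasDerivAt_neg_two_mul K r)
    · have h1 := hu.ge x hx.ge (by rw [hx]; exact hρR)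
      have h2 : φ (R + δ - ρ) ≤ φ (R - ρ) :=
        hφ.antitoneOn ⟨by linarith, hT⟩ ⟨(hτ ρ le_rfl hρR).1, (hτ ρ le_rfl hρR).2⟩ (by linarith)
      simp only [Pi.neg_apply]
      linarith
    · filter_upwards [hu.blowUp (φ δ), Ioo_mem_nhdsLT hρR] with r h1 h2 x hx
      have h3 : φ (R + δ - r) ≤ φ δ :=
        hφ.antitoneOn ⟨hδ0, by linarith⟩ ⟨(hτ r h2.1.le h2.2).1, (hτ r h2.1.le h2.2).2⟩
          (by linarith [h2.2])
      have h4 := h1 x hx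
      have h5 : 0 ≤ K * (R ^ 2 - r ^ 2) := mul_nonneg hK0 (by nlinarith [h2.1, h2.2])
      simp only [Pi.neg_apply]
      linarith
    · have hτx := hτ _ h1.le h2
      have hx0 : 0 < ‖x‖ := hρ.trans h1
      have hφx := hφ.gt _ hτx.1 hτx.2
      rw [InnerProductSpace.laplacian_neg, Pi.neg_apply, hu.equation x h1.le h2]
      have h4 : 0 ≤ K * (R ^ 2 - ‖x‖ ^ 2) := mul_nonneg hK0 (by nlinarith)
      have h5 : g (u x) ≤ g (φ (R + δ - ‖x‖)) := by
        simp only [Pi.neg_apply] at h3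
        exact hg.mono (hu.ge x h1.le h2) (mem_Ici.2 hφx.le) (by linarith)
      have h6 : 0 < √(2 * G (φ (R + δ - ‖x‖))) :=
        Real.sqrt_pos.2 (by linarith [hg.primitive_pos _ hφx.le])
      have h7 : 0 < ((Module.finrank ℝ E : ℝ) - 1) / ‖x‖ := div_pos (by linarith) hx0
      have h8 := mul_pos h7 h6
      have h9 : 0 ≤ ((Module.finrank ℝ E : ℝ) - 1) / ‖x‖ * (2 * K * ‖x‖) := by positivity
      simp only [mul_add, mul_neg]
      linarith
  have hlim : Tendsto (fun δ => φ (R + δ - ‖x‖) - K * (R ^ 2 - ‖x‖ ^ 2)) (𝓝[>] 0)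
      (𝓝 (φ (R - ‖x‖) - K * (R ^ 2 - ‖x‖ ^ 2))) := by
    have h1 : ContinuousAt φ (R - ‖x‖) := (hφ.hasDerivAt _ (by linarith) (by linarith)).continuousAt
    have h2 : Tendsto (fun δ => R + δ - ‖x‖) (𝓝[>] 0) (𝓝 (R - ‖x‖)) := by
      have : Continuous fun δ : ℝ => R + δ - ‖x‖ := by fun_prop
      have := this.tendsto 0
      rw [add_zero] at this
      exact this.mono_left nhdsWithin_le_nhds
    exact (h1.tendsto.comp h2).sub_const _
  refine le_of_tendsto hlim ?_
  filter_upwards [Ioo_mem_nhdsGT (show (0 : ℝ) < T - (R - ρ) by linarith)] with δ hδ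
    using key δ hδ.1 hδ.2

/-- Upper bound: the factor `exp (c (R - r))` compensates the curvature term
`(n - 1) / r * ∂u/∂r`, because `c ≥ (n - 1) / ρ` and `√(2G(t)) ≥ c (t - b)`. Shifted inwards by `δ`, the
barrier blows up on the sphere of radius `R - δ`, where `u` is finite. -/
theorem IsShellSolution.exists_le_profile (hu : IsShellSolution g b ρ R u)
    (hg : RegularTail g G b c) (hn : 2 ≤ Module.finrank ℝ E) (hρ : 0 < ρ) (hρR : ρ < R)
    (hc : ((Module.finrank ℝ E : ℝ) - 1) / ρ ≤ c)
    (hT : R - ρ < T) (hφ : IsBlowUpProfile g G b T φ) :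
    ∃ K, 0 ≤ K ∧ ∀ x, ρ < ‖x‖ → ‖x‖ < R →
      u x ≤ b + Real.exp (c * (R - ‖x‖)) * (φ (R - ‖x‖) - b) + K * (R ^ 2 - ‖x‖ ^ 2) := by
  have hn' : (2 : ℝ) ≤ Module.finrank ℝ E := by exact_mod_cast hn
  have hη : 0 < R ^ 2 - ρ ^ 2 := by nlinarith
  have hc0 : 0 < c := lt_of_lt_of_le (div_pos (by linarith) hρ) hc
  have hgb := hg.pos b le_rfl
  have hshell : ∀ ρ', ρ' < R → ∃ M, ∀ x : E, ρ ≤ ‖x‖ → ‖x‖ ≤ ρ' → u x ≤ M := by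
    intro ρ' hρ'
    have hK : IsCompact {y : E | ρ ≤ ‖y‖ ∧ ‖y‖ ≤ ρ'} := by
      refine (isCompact_closedBall (0 : E) ρ').of_isClosed_subset ?_ ?_
      · exact (isClosed_le continuous_const continuous_norm).inter
          (isClosed_le continuous_norm continuous_const)
      · intro y hy
        simpa using hy.2
    obtain ⟨M, hM⟩ := hK.exists_bound_of_continuousOn (f := u) fun y hy =>
      (hu.contDiffAt y hy.1 (hy.2.trans_lt hρ')).continuousAt.continuousWithinAt
    exact ⟨M, fun x h1 h2 => (le_abs_self _).trans (hM x ⟨h1, h2⟩)⟩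
  obtain ⟨M, hM⟩ := hshell ρ hρR
  set K := |M - b| / (R ^ 2 - ρ ^ 2) + Real.exp (c * R) * g b with hK
  have hK0 : 0 ≤ K := by positivity
  have hKρ : M - b ≤ K * (R ^ 2 - ρ ^ 2) := by
    rw [hK, add_mul, div_mul_cancel₀ _ hη.ne']
    have : 0 ≤ Real.exp (c * R) * g b * (R ^ 2 - ρ ^ 2) := by positivity
    linarith [le_abs_self (M - b)]
  have hKg : Real.exp (c * R) * g b ≤ K := by
    have : 0 ≤ |M - b| / (R ^ 2 - ρ ^ 2) := by positivity
    linarith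
  refine ⟨K, hK0, fun x hx1 hx2 => ?_⟩
  have key : ∀ δ, 0 < δ → δ < R - ‖x‖ →
      u x ≤ b + Real.exp (c * (R - δ - ‖x‖)) * (φ (R - δ - ‖x‖) - b)
        + K * (R ^ 2 - ‖x‖ ^ 2) := by
    intro δ hδ0 hδ1
    have hτ : ∀ r, ρ ≤ r → r < R - δ → 0 < R - δ - r ∧ R - δ - r < T := fun r h1 h2 =>
      ⟨by linarith, by linarith⟩
    have hexp : ∀ t : ℝ, HasDerivAt (fun t => Real.exp (c * t)) (Real.exp (c * t) * c) t :=
      fun t => by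
        have := ((hasDerivAt_id t).const_mul c).exp
        exact this.congr_deriv (by simp)
    have hΘ : ∀ t, 0 < t → t < T → HasDerivAt (fun t => Real.exp (c * t) * (φ t - b))
        (Real.exp (c * t) * (c * (φ t - b) + -√(2 * G (φ t)))) t := fun t h0 h1 =>
      ((hexp t).mul ((hφ.hasDerivAt t h0 h1).sub_const b)).congr_deriv (by ring)
    have hΘ' : ∀ t, 0 < t → t < T →
        HasDerivAt (fun t => Real.exp (c * t) * (c * (φ t - b) + -√(2 * G (φ t))))
        (Real.exp (c * t) * (c ^ 2 * (φ t - b) - 2 * c * √(2 * G (φ t)) + g (φ t))) t :=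
      fun t h0 h1 =>
        ((hexp t).mul ((((hφ.hasDerivAt t h0 h1).sub_const b).const_mul c).add
          (hφ.hasDerivAt' t h0 h1))).congr_deriv (by simp only [Pi.add_apply]; ring)
    refine le_radial_of_laplacian (U := u) hρ (R := R - δ)
      (ψ := fun r => b + Real.exp (c * (R - δ - r)) * (φ (R - δ - r) - b)
        + K * (R ^ 2 - r ^ 2))
      (ψ' := fun r => -(Real.exp (c * (R - δ - r)) *
        (c * (φ (R - δ - r) - b) + -√(2 * G (φ (R - δ - r))))) + -(2 * K * r))
      (ψ'' := fun r => Real.exp (c * (R - δ - r)) * (c ^ 2 * (φ (R - δ - r) - b)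
        - 2 * c * √(2 * G (φ (R - δ - r))) + g (φ (R - δ - r))) + -(2 * K))
      (fun x h1 h2 => hu.contDiffAt x h1 (by linarith))
      (fun r h1 h2 => ?_) (fun r h1 h2 => ?_) (fun x hx => ?_) ?_ (fun x h1 h2 h3 => ?_) x hx1.le
      (by linarith)
    · have := hasDerivAt_comp_const_sub (hΘ _ (hτ r h1 h2).1 (hτ r h1 h2).2)
      exact (this.const_add b).add (hasDerivAt_const_mul_sq_sub_sq K R r)
    · have := (hasDerivAt_comp_const_sub (hΘ' _ (hτ r h1.le h2).1 (hτ r h1.le h2).2)).neg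
      exact (this.add (hasDerivAt_neg_two_mul K r)).congr_deriv (by simp)
    · have h1 := hM x hx.ge hx.le
      have h2 := hφ.gt _ (hτ ρ le_rfl (by linarith)).1 (hτ ρ le_rfl (by linarith)).2
      have h3 : 0 ≤ Real.exp (c * (R - δ - ρ)) * (φ (R - δ - ρ) - b) :=
        mul_nonneg (Real.exp_pos _).le (by linarith)
      linarith
    · obtain ⟨M', hM'⟩ := hshell (R - δ) (by linarith)
      have h1 : Tendsto (fun r => R - δ - r) (𝓝[<] (R - δ)) (𝓝[>] 0) := by
        refine tendsto_nhdsWithin_iff.2 ⟨?_, ?_⟩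
        · have : Continuous fun r : ℝ => R - δ - r := by fun_prop
          have := this.tendsto (R - δ)
          rw [sub_self] at this
          exact this.mono_left nhdsWithin_le_nhds
        · filter_upwards [self_mem_nhdsWithin] with r hr
          exact mem_Ioi.2 (sub_pos.2 hr)
      filter_upwards [(hφ.tendsto.comp h1).eventually (eventually_ge_atTop M'),
        Ioo_mem_nhdsLT (show ρ < R - δ by linarith)] with r h2 h3 x hx
      have h4 := hM' x (hx ▸ h3.1.le) (hx ▸ h3.2.le)
      have h5 := hφ.gt _ (hτ r h3.1.le h3.2).1 (hτ r h3.1.le h3.2).2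
      have h6 : 1 ≤ Real.exp (c * (R - δ - r)) :=
        Real.one_le_exp (mul_nonneg hc0.le (hτ r h3.1.le h3.2).1.le)
      have h7 : 0 ≤ K * (R ^ 2 - r ^ 2) := mul_nonneg hK0 (by nlinarith [h3.1, h3.2])
      simp only [Function.comp_apply] at h2
      nlinarith
    · have hτx := hτ _ h1.le h2
      have hx0 : 0 < ‖x‖ := hρ.trans h1
      set t := R - δ - ‖x‖ with ht
      have hφx := hφ.gt _ hτx.1 hτx.2
      rw [hu.equation x h1.le (by linarith)]
      have hk1 : (0 : ℝ) ≤ (Module.finrank ℝ E : ℝ) - 1 := by linarith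
      have hk : ((Module.finrank ℝ E : ℝ) - 1) / ‖x‖ ≤ c :=
        (div_le_div_of_nonneg_left (by linarith) hρ h1.le).trans hc
      have hX1 : 1 ≤ Real.exp (c * t) := Real.one_le_exp (mul_nonneg hc0.le hτx.1.le)
      have hX2 : Real.exp (c * t) ≤ Real.exp (c * R) :=
        Real.exp_le_exp.2 (mul_le_mul_of_nonneg_left (by linarith) hc0.le)
      have h4 := hg.stretched_le hφx.le hX1 hc0.le hk
      have h5 : 0 ≤ Real.exp (c * t) * (φ t - b) :=
        mul_nonneg (Real.exp_pos _).le (by linarith)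
      have h6 : 0 ≤ K * (R ^ 2 - ‖x‖ ^ 2) := mul_nonneg hK0 (by nlinarith)
      have h7 : g (b + Real.exp (c * t) * (φ t - b)) ≤ g (u x) :=
        hg.mono (mem_Ici.2 (by linarith)) (hu.ge x h1.le (by linarith)) (by linarith)
      have h9 : Real.exp (c * t) * g b ≤ K := (mul_le_mul_of_nonneg_right hX2 hgb.le).trans hKg
      have h10 : 0 ≤ ((Module.finrank ℝ E : ℝ) - 1) / ‖x‖ * (2 * K * ‖x‖) := by positivity
      have e : ∀ k Y Z : ℝ, k * (-Y + -Z) = -(k * Y) - k * Z := fun k Y Z => by ring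
      rw [e]
      linarith
  have hlim : Tendsto (fun δ => b + Real.exp (c * (R - δ - ‖x‖)) * (φ (R - δ - ‖x‖) - b)
        + K * (R ^ 2 - ‖x‖ ^ 2)) (𝓝[>] 0)
      (𝓝 (b + Real.exp (c * (R - ‖x‖)) * (φ (R - ‖x‖) - b) + K * (R ^ 2 - ‖x‖ ^ 2))) := by
    have h1 : ContinuousAt φ (R - ‖x‖) := (hφ.hasDerivAt _ (by linarith) (by linarith)).continuousAt
    have h2 : Tendsto (fun δ => R - δ - ‖x‖) (𝓝[>] 0) (𝓝 (R - ‖x‖)) := by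
      have : Continuous fun δ : ℝ => R - δ - ‖x‖ := by fun_prop
      have := this.tendsto 0
      rw [sub_zero] at this
      exact this.mono_left nhdsWithin_le_nhds
    have h3 : ContinuousAt (fun t => b + Real.exp (c * t) * (φ t - b)
        + K * (R ^ 2 - ‖x‖ ^ 2)) (R - ‖x‖) := by fun_prop
    exact h3.tendsto.comp h2
  refine ge_of_tendsto hlim ?_
  filter_upwards [Ioo_mem_nhdsGT (sub_pos.2 hx2)] with δ hδ using key δ hδ.1 hδ.2

/-- The two barriers have ratio tending to `1`, so the values of a large solution on a sphere are
asymptotically equivalent. -/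
theorem IsShellSolution.eventually_le (hu : IsShellSolution g b ρ R u)
    (hg : RegularTail g G b c) (hn : 2 ≤ Module.finrank ℝ E) (hρ : 0 < ρ) (hρR : ρ < R)
    (hc : ((Module.finrank ℝ E : ℝ) - 1) / ρ ≤ c)
    (hT : R - ρ < T) (hφ : IsBlowUpProfile g G b T φ) {ε : ℝ} (hε : 0 < ε) :
    ∀ᶠ r in 𝓝[<] R, ∀ x y : E, ‖x‖ = r → ‖y‖ = r → u x ≤ u y + ε * (u y - b) := by
  obtain ⟨K₁, hK₁, h₁⟩ := hu.exists_le_profile hg hn hρ hρR hc hT hφ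
  obtain ⟨K₂, hK₂, h₂⟩ := hu.exists_profile_le hg hn hρ hρR hT hφ
  have hτ : Tendsto (fun r => R - r) (𝓝[<] R) (𝓝[>] 0) := by
    refine tendsto_nhdsWithin_iff.2 ⟨?_, ?_⟩
    · have : Continuous fun r : ℝ => R - r := by fun_prop
      have := this.tendsto R
      rw [sub_self] at this
      exact this.mono_left nhdsWithin_le_nhds
    · filter_upwards [self_mem_nhdsWithin] with r hr
      exact mem_Ioi.2 (sub_pos.2 hr)
  have hX : Tendsto (fun r => Real.exp (c * (R - r))) (𝓝[<] R) (𝓝 1) := by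
    have : Continuous fun r : ℝ => Real.exp (c * (R - r)) := by fun_prop
    have := this.tendsto R
    rw [sub_self, mul_zero, Real.exp_zero] at this
    exact this.mono_left nhdsWithin_le_nhds
  filter_upwards [hX.eventually (gt_mem_nhds (show (1 : ℝ) < 1 + ε / 2 by linarith)),
    (hφ.tendsto.comp hτ).eventually
      (eventually_ge_atTop (b + (K₁ + (1 + ε) * K₂) * R ^ 2 / (ε / 2))),
    Ioo_mem_nhdsLT hρR] with r h3 h4 h5 x y hx hy
  subst hx
  have h6 := h₁ x h5.1 h5.2
  have h7 := h₂ y (hy ▸ h5.1.le) (hy ▸ h5.2)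
  rw [hy] at h7
  simp only [Function.comp_apply] at h4
  have h8 : (K₁ + (1 + ε) * K₂) * R ^ 2 ≤ (φ (R - ‖x‖) - b) * (ε / 2) := by
    rw [← div_le_iff₀ (by positivity)]
    linarith
  have h9 : (K₁ + (1 + ε) * K₂) * (R ^ 2 - ‖x‖ ^ 2) ≤ (K₁ + (1 + ε) * K₂) * R ^ 2 :=
    mul_le_mul_of_nonneg_left (by nlinarith [sq_nonneg ‖x‖]) (by positivity)
  have h10 := hφ.gt (R - ‖x‖) (by linarith [h5.2]) (by linarith [h5.1])
  have h11 := mul_le_mul_of_nonneg_right h3.le (by linarith : 0 ≤ φ (R - ‖x‖) - b)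
  have h12 := mul_le_mul_of_nonneg_left h7 (by linarith : 0 ≤ 1 + ε)
  nlinarith

/-- By convexity of `g` the mean of two rotated copies of `u` is a subsolution, and
`u + ε (u - b) + (A + ε g(b)) (R² - r²)` is a supersolution which dominates it near the outer sphere
for every `ε > 0`. Letting `ε → 0`, a bound for the second difference at the inner sphere propagates
outwards with a factor that vanishes at the outer sphere. -/
theorem IsShellSolution.secondDifference_le (hu : IsShellSolution g b ρ R u)
    (hg : RegularTail g G b c) (hρ : 0 < ρ) (hρR : ρ < R) (hn : 2 ≤ Module.finrank ℝ E)
    (hratio : ∀ ε > 0, ∀ᶠ r in 𝓝[<] R, ∀ x y : E, ‖x‖ = r → ‖y‖ = r →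
      u x ≤ u y + ε * (u y - b)) (S T : E →ₗᵢ[ℝ] E) {A : ℝ} (hA : 0 ≤ A)
    (hin : ∀ x, ‖x‖ = ρ → u (S x) + u (T x) - 2 * u x ≤ 2 * A * (R ^ 2 - ρ ^ 2)) (x : E)
    (hx1 : ρ ≤ ‖x‖) (hx2 : ‖x‖ < R) :
    u (S x) + u (T x) - 2 * u x ≤ 2 * A * (R ^ 2 - ‖x‖ ^ 2) := by
  have hn' : (2 : ℝ) ≤ Module.finrank ℝ E := by exact_mod_cast hn
  have hη : 0 < R ^ 2 - ρ ^ 2 := by nlinarith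
  have hgb := hg.pos b le_rfl
  have key : ∀ ε > 0, (1 / 2) * (u (S x) + u (T x)) - (1 + ε) * u x ≤
      -ε * b + (A + ε * g b) * (R ^ 2 - ‖x‖ ^ 2) := by
    intro ε hε
    set B := A + ε * g b with hB
    have hB0 : 0 ≤ B := by positivity
    have hsmul : ∀ (a : ℝ) (f : E → ℝ) (x : E), ContDiffAt ℝ 2 f x → ContDiffAt ℝ 2 (a • f) x :=
      fun a f x hf => hf.const_smul a
    have hcomp : ∀ (L : E →ₗᵢ[ℝ] E) (x : E), ρ ≤ ‖x‖ → ‖x‖ < R →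
        ContDiffAt ℝ 2 (fun y => u (L y)) x := fun L x h1 h2 =>
      ContDiffAt.comp x (hu.contDiffAt (L x) (by rwa [L.norm_map]) (by rwa [L.norm_map]))
        L.contDiff.contDiffAt
    refine le_radial_of_laplacian (R := R) hρ
      (U := (1 / 2 : ℝ) • ((fun y => u (S y)) + fun y => u (T y)) - (1 + ε) • u)
      (ψ := fun r => -ε * b + B * (R ^ 2 - r ^ 2)) (ψ' := fun r => -(2 * B * r))
      (ψ'' := fun _ => -(2 * B)) (fun x h1 h2 => ?_)
      (fun r _ _ => (hasDerivAt_const_mul_sq_sub_sq B R r).const_add _)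
      (fun r _ _ => hasDerivAt_neg_two_mul B r) (fun x hx => ?_) ?_ (fun x h1 h2 h3 => ?_) x hx1 hx2
    · exact (hsmul _ _ x ((hcomp S x h1 h2).add (hcomp T x h1 h2))).sub
        (hsmul _ _ x (hu.contDiffAt x h1 h2))
    · have h1 := hin x hx
      have h2 := hu.ge x hx.ge (hx ▸ hρR)
      have h3 : 0 ≤ ε * g b * (R ^ 2 - ρ ^ 2) := by positivity
      simp only [Pi.sub_apply, Pi.smul_apply, Pi.add_apply, smul_eq_mul]
      nlinarith
    · filter_upwards [hratio ε hε, Ioo_mem_nhdsLT hρR] with r h1 h2 x hx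
      have h3 := h1 (S x) x (by rw [S.norm_map, hx]) hx
      have h4 := h1 (T x) x (by rw [T.norm_map, hx]) hx
      have h5 : 0 ≤ B * (R ^ 2 - r ^ 2) := mul_nonneg hB0 (by nlinarith [h2.1, h2.2])
      simp only [Pi.sub_apply, Pi.smul_apply, Pi.add_apply, smul_eq_mul]
      linarith
    · have hx0 : 0 < ‖x‖ := hρ.trans h1
      have hS1 : ρ ≤ ‖S x‖ := by rw [S.norm_map]; exact h1.le
      have hS2 : ‖S x‖ < R := by rwa [S.norm_map]
      have hT1 : ρ ≤ ‖T x‖ := by rw [T.norm_map]; exact h1.le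
      have hT2 : ‖T x‖ < R := by rwa [T.norm_map]
      have e : Laplacian.laplacian
          ((1 / 2 : ℝ) • ((fun y => u (S y)) + fun y => u (T y)) - (1 + ε) • u) x =
          1 / 2 * (g (u (S x)) + g (u (T x))) - (1 + ε) * g (u x) := by
        have hadd : ContDiffAt ℝ 2 ((fun y => u (S y)) + fun y => u (T y)) x :=
          (hcomp S x h1.le h2).add (hcomp T x h1.le h2)
        rw [ContDiffAt.laplacian_sub (hsmul _ _ x hadd) (hsmul _ _ x (hu.contDiffAt x h1.le h2)),
          InnerProductSpace.laplacian_smul _ hadd,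
          InnerProductSpace.laplacian_smul _ (hu.contDiffAt x h1.le h2),
          ContDiffAt.laplacian_add (hcomp S x h1.le h2) (hcomp T x h1.le h2),
          laplacian_comp_linearIsometry, laplacian_comp_linearIsometry, hu.equation x h1.le h2,
          hu.equation _ hS1 hS2, hu.equation _ hT1 hT2]
        simp only [smul_eq_mul]
      rw [e]
      simp only [Pi.sub_apply, Pi.smul_apply, Pi.add_apply, smul_eq_mul] at h3
      have hux := hu.ge x h1.le h2
      have huS := hu.ge _ hS1 hS2
      have huT := hu.ge _ hT1 hT2
      have h4 : 0 ≤ B * (R ^ 2 - ‖x‖ ^ 2) := mul_nonneg hB0 (by nlinarith)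
      have hconv := hg.convex.2
      have h5 := hconv (mem_Ici.2 huS) (mem_Ici.2 huT) (a := (1 / 2 : ℝ))
        (b := (1 / 2 : ℝ)) (by norm_num) (by norm_num) (by norm_num)
      have h6 : g (u x + ε * (u x - b)) ≤ g ((1 / 2 : ℝ) • u (S x) + (1 / 2 : ℝ) • u (T x)) := by
        refine hg.mono (mem_Ici.2 (by nlinarith)) (mem_Ici.2 ?_) ?_ <;>
        · simp only [smul_eq_mul]
          linarith
      have h7 : (1 + ε) * g (u x) ≤ g (u x + ε * (u x - b)) + ε * g b := by
        have h8 := hg.mul_le hux (by linarith : 1 ≤ 1 + ε)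
        have e1 : b + (1 + ε) * (u x - b) = u x + ε * (u x - b) := by ring
        rw [e1] at h8
        linarith
      simp only [smul_eq_mul] at h5 h6
      have e3 : ((Module.finrank ℝ E : ℝ) - 1) / ‖x‖ * -(2 * B * ‖x‖) =
          -(2 * ((Module.finrank ℝ E : ℝ) - 1) * B) := by
        field_simp
      rw [e3]
      have h8 : ε * g b ≤ B := by linarith
      have h9 : 0 < ε * g b := mul_pos hε hgb
      nlinarith
  have hl : Tendsto (fun ε : ℝ => (1 / 2) * (u (S x) + u (T x)) - (1 + ε) * u x) (𝓝[>] 0)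
      (𝓝 ((1 / 2) * (u (S x) + u (T x)) - (1 + 0) * u x)) :=
    (Continuous.tendsto (by fun_prop) 0).mono_left nhdsWithin_le_nhds
  have hr : Tendsto (fun ε : ℝ => -ε * b + (A + ε * g b) * (R ^ 2 - ‖x‖ ^ 2)) (𝓝[>] 0)
      (𝓝 (-0 * b + (A + 0 * g b) * (R ^ 2 - ‖x‖ ^ 2))) :=
    (Continuous.tendsto (by fun_prop) 0).mono_left nhdsWithin_le_nhds
  have := le_of_tendsto_of_tendsto hl hr
    (by filter_upwards [self_mem_nhdsWithin] with ε hε using key ε hε)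
  linarith

end Barriers

end LargeSolution

namespace LargeSolution

open Set
open scoped RealInnerProductSpace

/-! ### Angular and radial derivatives near the boundary -/

section Derivatives

variable {E : Type*} [NormedAddCommGroup E] [InnerProductSpace ℝ E] [FiniteDimensional ℝ E]
  {g G : ℝ → ℝ} {b c ρ R : ℝ} {u : E → ℝ}

/-- The left-hand side is the second derivative of `u` along the great circle
`s ↦ r (cos s • e + sin s • f)` at `s = 0`. -/
theorem IsShellSolution.exists_circle_secondDeriv_le (hu : IsShellSolution g b ρ R u)
    (hg : RegularTail g G b c) (hρ : 0 < ρ) (hρR : ρ < R) (hn : 2 ≤ Module.finrank ℝ E)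
    (hratio : ∀ ε > 0, ∀ᶠ r in 𝓝[<] R, ∀ x y : E, ‖x‖ = r → ‖y‖ = r →
      u x ≤ u y + ε * (u y - b)) :
    ∃ C, 0 ≤ C ∧ ∀ (e f : E) (r : ℝ), ‖e‖ = 1 → ‖f‖ = 1 → ⟪e, f⟫ = 0 → ρ ≤ r → r < R →
      fderiv ℝ (fderiv ℝ u) (r • e) (r • f) (r • f) + fderiv ℝ u (r • e) (-(r • e)) ≤
        C * (R ^ 2 - r ^ 2) := by
  have hη : 0 < R ^ 2 - ρ ^ 2 := by nlinarith
  obtain ⟨C, hC0, hC⟩ := exists_rotation_secondDifference_le (u := u) (ρ := ρ)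
    fun x hx => hu.contDiffAt x hx.ge (hx ▸ hρR)
  refine ⟨C / (R ^ 2 - ρ ^ 2), by positivity, fun e f r he hf hef h1 h2 => ?_⟩
  have hr : 0 < r := hρ.trans_le h1
  have hx : ‖r • e‖ = r := by rw [norm_smul, he, mul_one, Real.norm_of_nonneg hr.le]
  have hdiff : ∀ h : ℝ, u (planeRotation he hf hef h (r • e)) +
      u (planeRotation he hf hef (-h) (r • e)) - 2 * u (r • e) ≤
      C / (R ^ 2 - ρ ^ 2) * (R ^ 2 - r ^ 2) * h ^ 2 := by
    intro h
    have := hu.secondDifference_le hg hρ hρR hn hratio (planeRotation he hf hef h)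
      (planeRotation he hf hef (-h)) (A := C * h ^ 2 / (2 * (R ^ 2 - ρ ^ 2))) (by positivity)
      (fun x hx => by
        refine (hC he hf hef h x hx).trans (le_of_eq ?_)
        field_simp) (r • e) (by rwa [hx]) (by rwa [hx])
    refine this.trans (le_of_eq ?_)
    rw [hx]
    field_simp
  have hγ0 : (0 : E) + (Real.cos 0 • (r • e) + Real.sin 0 • (r • f)) = r • e := by simp
  have hd := hasDerivAt_ellipse (0 : E) (r • e) (r • f)
  have hU : ContDiffAt ℝ 2 u (r • e) := hu.contDiffAt _ (by rwa [hx]) (by rwa [hx])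
  have hev : ∀ᶠ s in 𝓝 (0 : ℝ),
      ContDiffAt ℝ 2 u (0 + (Real.cos s • (r • e) + Real.sin s • (r • f))) := by
    have h3 := (hd 0).continuousAt.tendsto
    simp only [hγ0] at h3
    exact h3.eventually (hU.eventually (by norm_num))
  have h4 := secondDeriv_le_of_secondDifference_le
    (f := fun s => u (0 + (Real.cos s • (r • e) + Real.sin s • (r • f))))
    (hev.mono fun s hs => hasDerivAt_comp_curve hs (hd s))
    (hasDerivAt_fderiv_comp_curve (by rw [hγ0]; exact hU) (hd 0)
      (hasDerivAt_ellipse' (r • e) (r • f) 0))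
    (K := C / (R ^ 2 - ρ ^ 2) * (R ^ 2 - r ^ 2)) (fun h => by
      have := hdiff h
      rw [planeRotation_apply_smul, planeRotation_apply_smul] at this
      simpa only [hγ0] using this)
  simpa using h4

/-- Along a full great circle the angular derivative is periodic with mean zero, so the one-sided
bound on the second derivative bounds it. -/
theorem IsShellSolution.fderiv_tangent_le (hu : IsShellSolution g b ρ R u) (hρ : 0 < ρ)
    {C : ℝ} (hC0 : 0 ≤ C)
    (hC : ∀ (e f : E) (r : ℝ), ‖e‖ = 1 → ‖f‖ = 1 → ⟪e, f⟫ = 0 → ρ ≤ r → r < R →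
      fderiv ℝ (fderiv ℝ u) (r • e) (r • f) (r • f) + fderiv ℝ u (r • e) (-(r • e)) ≤
        C * (R ^ 2 - r ^ 2))
    {e f : E} {r : ℝ} (he : ‖e‖ = 1) (hf : ‖f‖ = 1) (hef : ⟪e, f⟫ = 0) (h1 : ρ ≤ r) (h2 : r < R) :
    fderiv ℝ u (r • e) (r • f) ≤ C * (R ^ 2 - r ^ 2) * (2 * Real.pi) := by
  have hr : 0 < r := hρ.trans_le h1
  set γ : ℝ → E := fun s => 0 + (Real.cos s • (r • e) + Real.sin s • (r • f)) with hγ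
  have hγe : ∀ s, γ s = r • (Real.cos s • e + Real.sin s • f) := fun s => by
    simp only [hγ]
    module
  have hγn : ∀ s, ‖γ s‖ = r := fun s => by
    rw [hγe, norm_smul, norm_cos_smul_add_sin_smul he hf hef, mul_one, Real.norm_of_nonneg hr.le]
  have hU : ∀ s, ContDiffAt ℝ 2 u (γ s) := fun s =>
    hu.contDiffAt _ (by rwa [hγn]) (by rwa [hγn])
  have hd := hasDerivAt_ellipse (0 : E) (r • e) (r • f)
  have hd' := hasDerivAt_ellipse' (r • e) (r • f)
  have key := deriv_le_of_periodic (f := fun s => u (γ s)) (T := 2 * Real.pi) Real.two_pi_pos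
    (fun s => hasDerivAt_comp_curve (hU s) (hd s))
    (fun s => hasDerivAt_fderiv_comp_curve (hU s) (hd s) (hd' s))
    (K := C * (R ^ 2 - r ^ 2)) (fun s => ?_) (mul_nonneg hC0 (by nlinarith)) (by simp [hγ])
  · simpa [hγ] using key
  -- The frame at the angle `s` is again orthonormal, so that the bound at angle `0` applies to it.
  have hfs : ‖(-Real.sin s) • e + Real.cos s • f‖ = 1 := by
    have := norm_cos_smul_add_sin_smul he hf hef (s + Real.pi / 2)
    rwa [Real.cos_add_pi_div_two, Real.sin_add_pi_div_two] at this
  have horth : ⟪Real.cos s • e + Real.sin s • f, (-Real.sin s) • e + Real.cos s • f⟫ = 0 := by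
    have hfe : ⟪f, e⟫ = 0 := by rw [real_inner_comm, hef]
    simp only [inner_add_left, inner_add_right, real_inner_smul_left, real_inner_smul_right, hef,
      hfe, real_inner_self_eq_norm_sq, he, hf]
    ring
  have h3 := hC _ _ r (norm_cos_smul_add_sin_smul he hf hef s) hfs horth h1 h2
  have e1 : (-Real.sin s) • (r • e) + Real.cos s • (r • f) =
      r • ((-Real.sin s) • e + Real.cos s • f) := by module
  have e2 : Real.cos s • (r • e) + Real.sin s • (r • f) =
      r • (Real.cos s • e + Real.sin s • f) := by module
  rw [hγe, e1, e2]
  exact h3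

/-- On a ray, the bound on the angular second derivatives turns the equation into
`(r^(n-1) q')' ≥ 0` for `q r = u (r • e)` near the outer sphere; with the mean value theorem, `q'`
is then bounded below by a multiple of the increase of `q`. -/
theorem IsShellSolution.exists_le_fderiv_radial (hu : IsShellSolution g b ρ R u)
    (hg : RegularTail g G b c) (hρ : 0 < ρ) (hρR : ρ < R) (hn : 2 ≤ Module.finrank ℝ E)
    {C : ℝ} (hC0 : 0 ≤ C)
    (hC : ∀ (e f : E) (r : ℝ), ‖e‖ = 1 → ‖f‖ = 1 → ⟪e, f⟫ = 0 → ρ ≤ r → r < R →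
      fderiv ℝ (fderiv ℝ u) (r • e) (r • f) (r • f) + fderiv ℝ u (r • e) (-(r • e)) ≤
        C * (R ^ 2 - r ^ 2)) :
    ∃ ρ₁ M κ : ℝ, ρ₁ < R ∧ 0 < κ ∧ ∀ (e : E) (r : ℝ), ‖e‖ = 1 → ρ₁ < r → r < R → M ≤ u (r • e) →
      κ * (u (r • e) - M) ≤ fderiv ℝ u (r • e) e := by
  have hn' : (2 : ℝ) ≤ Module.finrank ℝ E := by exact_mod_cast hn
  have hR : 0 < R := hρ.trans hρR
  have hgb := hg.pos b le_rfl
  obtain ⟨ρ₁, h1, hρ₁R, hsmall⟩ : ∃ ρ₁, ρ < ρ₁ ∧ ρ₁ < R ∧ ∀ r, ρ₁ ≤ r → r < R →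
      ((Module.finrank ℝ E : ℝ) - 1) * (C * (R ^ 2 - r ^ 2)) ≤ g b * ρ ^ 2 := by
    have hl : Tendsto (fun r => ((Module.finrank ℝ E : ℝ) - 1) * (C * (R ^ 2 - r ^ 2))) (𝓝[<] R)
        (𝓝 (((Module.finrank ℝ E : ℝ) - 1) * (C * (R ^ 2 - R ^ 2)))) :=
      (Continuous.tendsto (by fun_prop) R).mono_left nhdsWithin_le_nhds
    rw [sub_self, mul_zero, mul_zero] at hl
    have h2 := hl.eventually (gt_mem_nhds (by positivity : 0 < g b * ρ ^ 2))
    obtain ⟨ρ₁, h3, h4⟩ := (h2.and (Ioo_mem_nhdsLT hρR)).exists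
    refine ⟨ρ₁, h4.1, h4.2, fun r h5 h6 => le_trans ?_ h3.le⟩
    refine mul_le_mul_of_nonneg_left (mul_le_mul_of_nonneg_left ?_ hC0) (by linarith)
    nlinarith [h4.1]
  have hρ₁ : 0 < ρ₁ := hρ.trans h1
  obtain ⟨m, hm⟩ : ∃ m : ℕ, Module.finrank ℝ E = m + 2 := ⟨_, (Nat.sub_add_cancel hn).symm⟩
  have hm' : (Module.finrank ℝ E : ℝ) - 1 = m + 1 := by rw [hm]; push_cast; ring
  obtain ⟨M, hM⟩ := (isCompact_sphere (0 : E) ρ₁).exists_bound_of_continuousOn (f := u)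
    fun x hx => (hu.contDiffAt x (by rw [mem_sphere_zero_iff_norm.1 hx]; exact h1.le)
      (by rw [mem_sphere_zero_iff_norm.1 hx]; exact hρ₁R)).continuousAt.continuousWithinAt
  refine ⟨ρ₁, M, ρ₁ ^ (m + 1) / R ^ (m + 2), hρ₁R, by positivity, ?_⟩
  intro e r he hr1 hr2 hMr
  have hnorm : ∀ s : ℝ, ρ₁ ≤ s → ‖s • e‖ = s := fun s hs => by
    rw [norm_smul, he, mul_one, Real.norm_of_nonneg (hρ₁.le.trans hs)]
  have hU : ∀ s : ℝ, ρ₁ ≤ s → s < R → ContDiffAt ℝ 2 u (s • e) := fun s h3 h4 =>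
    hu.contDiffAt _ (by rw [hnorm s h3]; linarith) (by rwa [hnorm s h3])
  have hray : ∀ s : ℝ, HasDerivAt (fun s : ℝ => s • e) e s := fun s => by
    simpa using (hasDerivAt_id s).smul_const e
  have hq : ∀ s : ℝ, ρ₁ ≤ s → s < R →
      HasDerivAt (fun s : ℝ => u (s • e)) (fderiv ℝ u (s • e) e) s := fun s h3 h4 =>
    hasDerivAt_comp_curve (γ := fun s : ℝ => s • e) (hU s h3 h4) (hray s)
  have hq' : ∀ s : ℝ, ρ₁ ≤ s → s < R → HasDerivAt (fun s : ℝ => fderiv ℝ u (s • e) e)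
      (fderiv ℝ (fderiv ℝ u) (s • e) e e) s := fun s h3 h4 => by
    have := hasDerivAt_fderiv_comp_curve (γ := fun s : ℝ => s • e) (γ' := fun _ => e)
      (hU s h3 h4) (hray s) (hasDerivAt_const s e)
    simpa using this
  have hode : ∀ s : ℝ, ρ₁ ≤ s → s < R →
      0 ≤ fderiv ℝ (fderiv ℝ u) (s • e) e e + (m + 1) * (fderiv ℝ u (s • e) e / s) := by
    intro s h3 h4
    have hs : 0 < s := hρ₁.trans_le h3
    have h5 := laplacian_le_of_frame (u := u) (x := s • e) (e := e)
      (A := fderiv ℝ (fderiv ℝ u) (s • e) e e)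
      (B := fderiv ℝ u (s • e) e / s + C * (R ^ 2 - s ^ 2) / s ^ 2) he le_rfl fun f hf hef => by
        have h6 := hC e f s he hf hef (by linarith) h4
        simp only [map_smul, map_neg, smul_apply, smul_eq_mul] at h6
        have e1 : fderiv ℝ u (s • e) e / s + C * (R ^ 2 - s ^ 2) / s ^ 2 =
            (s * fderiv ℝ u (s • e) e + C * (R ^ 2 - s ^ 2)) / s ^ 2 := by
          field_simp
        rw [e1, le_div_iff₀ (by positivity)]
        linarith
    have hxρ : ρ ≤ ‖s • e‖ := by rw [hnorm s h3]; linarith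
    have hxR : ‖s • e‖ < R := by rwa [hnorm s h3]
    rw [hu.equation _ hxρ hxR] at h5
    have h6 : g b ≤ g (u (s • e)) :=
      hg.mono self_mem_Ici (hu.ge _ hxρ hxR) (hu.ge _ hxρ hxR)
    have h7 : ((Module.finrank ℝ E : ℝ) - 1) * (C * (R ^ 2 - s ^ 2) / s ^ 2) ≤ g b := by
      rw [← mul_div_assoc, div_le_iff₀ (by positivity)]
      refine (hsmall s h3 h4).trans (mul_le_mul_of_nonneg_left ?_ hgb.le)
      nlinarith
    rw [mul_add] at h5
    rw [hm'] at h5 h7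
    linarith
  have hpd : ∀ s : ℝ, ρ₁ ≤ s → s < R →
      HasDerivAt (fun s : ℝ => s ^ (m + 1) * fderiv ℝ u (s • e) e)
        (s ^ (m + 1) * (fderiv ℝ (fderiv ℝ u) (s • e) e e +
          (m + 1) * (fderiv ℝ u (s • e) e / s))) s := fun s h3 h4 => by
    have hs : 0 < s := hρ₁.trans_le h3
    refine ((hasDerivAt_pow (m + 1) s).mul (hq' s h3 h4)).congr_deriv ?_
    simp only [Nat.add_sub_cancel, Nat.cast_add, Nat.cast_one, pow_succ]
    field_simp
    ring
  have hmono : MonotoneOn (fun s : ℝ => s ^ (m + 1) * fderiv ℝ u (s • e) e) (Ico ρ₁ R) := by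
    refine monotoneOn_of_deriv_nonneg (convex_Ico _ _)
      (fun s hs => (hpd s hs.1 hs.2).continuousAt.continuousWithinAt) ?_ ?_
    · intro s hs
      rw [interior_Ico] at hs
      exact (hpd s hs.1.le hs.2).differentiableAt.differentiableWithinAt
    · intro s hs
      rw [interior_Ico] at hs
      rw [(hpd s hs.1.le hs.2).deriv]
      exact mul_nonneg (pow_nonneg (hρ₁.trans hs.1).le _) (hode s hs.1.le hs.2)
  obtain ⟨ξ, hξ, hξs⟩ := exists_hasDerivAt_eq_slope (fun s : ℝ => u (s • e))
    (fun s => fderiv ℝ u (s • e) e) hr1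
    (fun s hs => (hq s hs.1 (hs.2.trans_lt hr2)).continuousAt.continuousWithinAt)
    (fun s hs => hq s hs.1.le (hs.2.trans hr2))
  have hM1 : u (ρ₁ • e) ≤ M := (le_abs_self _).trans
    (hM _ (mem_sphere_zero_iff_norm.2 (hnorm ρ₁ le_rfl)))
  have h3 : (u (r • e) - M) / R ≤ fderiv ℝ u (ξ • e) e := by
    rw [hξs]
    exact div_le_div₀ (by linarith) (by linarith) (by linarith) (by linarith)
  have h4 : 0 ≤ (u (r • e) - M) / R := div_nonneg (by linarith) hR.le
  have h5 : ξ ^ (m + 1) * fderiv ℝ u (ξ • e) e ≤ r ^ (m + 1) * fderiv ℝ u (r • e) e :=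
    hmono ⟨hξ.1.le, hξ.2.trans hr2⟩ ⟨hr1.le, hr2⟩ hξ.2.le
  have h6 : ρ₁ ^ (m + 1) * ((u (r • e) - M) / R) ≤ ξ ^ (m + 1) * fderiv ℝ u (ξ • e) e :=
    mul_le_mul (pow_le_pow_left₀ hρ₁.le hξ.1.le _) h3 h4 (pow_nonneg (hρ₁.trans hξ.1).le _)
  have hr0 : 0 < r := hρ₁.trans hr1
  have h7 : 0 ≤ fderiv ℝ u (r • e) e := by
    have : 0 ≤ r ^ (m + 1) * fderiv ℝ u (r • e) e :=
      le_trans (mul_nonneg (by positivity) h4) (h6.trans h5)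
    exact nonneg_of_mul_nonneg_right this (by positivity)
  have h8 : r ^ (m + 1) * fderiv ℝ u (r • e) e ≤ R ^ (m + 1) * fderiv ℝ u (r • e) e :=
    mul_le_mul_of_nonneg_right (pow_le_pow_left₀ hr0.le hr2.le _) h7
  have h9 := h6.trans (h5.trans h8)
  have e2 : ρ₁ ^ (m + 1) / R ^ (m + 2) * (u (r • e) - M) =
      ρ₁ ^ (m + 1) * ((u (r • e) - M) / R) / R ^ (m + 1) := by
    field_simp
    ring
  rw [e2, div_le_iff₀ (by positivity)]
  linarith

end Derivatives

section Euclidean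

variable {N : ℕ} {u : EuclideanSpace ℝ (Fin N) → ℝ}

theorem inner_gradient_eq_fderiv (x v : EuclideanSpace ℝ (Fin N)) :
    ⟪gradient u x, v⟫ = fderiv ℝ u x v :=
  InnerProductSpace.toDual_symm_apply

theorem radialDeriv_eq_fderiv (x : EuclideanSpace ℝ (Fin N)) :
    radialDeriv u x = fderiv ℝ u x (‖x‖⁻¹ • x) :=
  inner_gradient_eq_fderiv x _

theorem tangentialGradient_eq (x : EuclideanSpace ℝ (Fin N)) :
    tangentialGradient u x = gradient u x - radialDeriv u x • (‖x‖⁻¹ • x) := by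
  rw [tangentialGradient, smul_smul, mul_comm]

/-- The norm of the tangential gradient is itself a tangential derivative, in the direction of that
gradient. -/
theorem norm_tangentialGradient_le {x : EuclideanSpace ℝ (Fin N)} (hx : x ≠ 0) {K : ℝ}
    (hK0 : 0 ≤ K)
    (hK : ∀ f, ‖f‖ = 1 → ⟪‖x‖⁻¹ • x, f⟫ = 0 → fderiv ℝ u x f ≤ K) :
    ‖tangentialGradient u x‖ ≤ K := by
  set e := ‖x‖⁻¹ • x with he
  set w := tangentialGradient u x with hw
  have hen : ‖e‖ = 1 := norm_smul_inv_norm hx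
  have hwe : w = gradient u x - radialDeriv u x • e := tangentialGradient_eq x
  have hew : ⟪e, w⟫ = 0 := by
    rw [hwe, inner_sub_right, real_inner_smul_right, real_inner_self_eq_norm_sq, hen,
      real_inner_comm, radialDeriv, ← he]
    ring
  by_cases h0 : w = 0
  · rw [h0, norm_zero]
    exact hK0
  have hwn : ‖w‖ ≠ 0 := norm_ne_zero_iff.2 h0
  have h1 := hK (‖w‖⁻¹ • w) (norm_smul_inv_norm h0) (by rw [real_inner_smul_right, hew, mul_zero])
  have h2 : gradient u x = w + radialDeriv u x • e := by rw [hwe]; abel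
  rw [← inner_gradient_eq_fderiv, h2, inner_add_left, real_inner_smul_left, real_inner_smul_right,
    real_inner_smul_right, hew, real_inner_self_eq_norm_sq] at h1
  have e1 : ‖w‖⁻¹ * ‖w‖ ^ 2 + radialDeriv u x * (‖w‖⁻¹ * 0) = ‖w‖ := by
    field_simp
    ring
  rwa [e1] at h1

end Euclidean

end LargeSolution

open LargeSolution

/-! ### Boundary behaviour of the gradient -/

theorem mainTheorem3 (N : ℕ) (hN : 2 ≤ N) (R : ℝ) (hR : 0 < R) (g : ℝ → ℝ)
    (hg : ∃ a : ℝ, 0 < a ∧ (∀ s ∈ Set.Ici a, 0 < g s) ∧ ConvexOn ℝ (Set.Ici a) g ∧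
      KellerOsserman g a)
    (u : EuclideanSpace ℝ (Fin N) → ℝ) (hu : IsLargeSolution g R u) :
    Tendsto (tangentialGradient u) (nearSphere N R) (𝓝 0) ∧
      Tendsto (radialDeriv u) (nearSphere N R) atTop := by
  obtain ⟨a, ha, hpos, hconv, hKO⟩ := hg
  have hN' : (2 : ℝ) ≤ N := by exact_mod_cast hN
  have hfin : Module.finrank ℝ (EuclideanSpace ℝ (Fin N)) = N := finrank_euclideanSpace_fin
  have hn : 2 ≤ Module.finrank ℝ (EuclideanSpace ℝ (Fin N)) := by rw [hfin]; exact hN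
  have hc0 : 0 < ((N : ℝ) - 1) / (R / 2) := div_pos (by linarith) (by linarith)
  obtain ⟨G, b, hg⟩ := exists_regularTail ha hpos hconv hKO hc0
  obtain ⟨T, φ, hT, hφ⟩ := hg.exists_profile
  have hblow : ∀ M : ℝ, ∀ᶠ r in 𝓝[<] R, ∀ x : EuclideanSpace ℝ (Fin N), ‖x‖ = r → M ≤ u x :=
    fun M => eventually_comap.1 (hu.blowUp.eventually (eventually_ge_atTop M))
  -- A shell so thin that `u ≥ b` in it, and that the profile is defined on its width.
  obtain ⟨ρ, hρ2, hρT, hρR, hρb⟩ : ∃ ρ, R / 2 < ρ ∧ R - T < ρ ∧ ρ < R ∧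
      ∀ x : EuclideanSpace ℝ (Fin N), ρ ≤ ‖x‖ → ‖x‖ < R → b ≤ u x := by
    obtain ⟨ρ₀, h1, h2⟩ := (mem_nhdsLT_iff_exists_Ioo_subset).1 (hblow b)
    obtain ⟨ρ, h3, h4⟩ := exists_between
      (max_lt (max_lt (show R / 2 < R by linarith) (show R - T < R by linarith)) h1)
    refine ⟨ρ, ?_, ?_, h4, fun x h5 h6 => h2 ⟨?_, h6⟩ x rfl⟩
    · exact ((le_max_left _ _).trans (le_max_left _ _)).trans_lt h3
    · exact ((le_max_right _ _).trans (le_max_left _ _)).trans_lt h3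
    · exact ((le_max_right _ _).trans_lt h3).trans_le h5
  have hρ : 0 < ρ := by linarith
  have hball : ∀ x : EuclideanSpace ℝ (Fin N), ‖x‖ < R → x ∈ Metric.ball 0 R := fun x hx => by
    simpa using hx
  have hs : IsShellSolution g b ρ R u :=
    ⟨fun x _ h2 => hu.contDiffOn.contDiffAt (Metric.isOpen_ball.mem_nhds (hball x h2)),
      fun x _ h2 => by linarith [hu.equation x (hball x h2)], hρb, hblow⟩
  have hc : ((Module.finrank ℝ (EuclideanSpace ℝ (Fin N)) : ℝ) - 1) / ρ ≤
      ((N : ℝ) - 1) / (R / 2) := by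
    rw [hfin]
    exact div_le_div_of_nonneg_left (by linarith) (by linarith) hρ2.le
  obtain ⟨C, hC0, hC⟩ := hs.exists_circle_secondDeriv_le hg hρ hρR hn fun ε hε =>
    hs.eventually_le hg hn hρ hρR hc (by linarith) hφ hε
  have hnear : Tendsto (fun x : EuclideanSpace ℝ (Fin N) => ‖x‖) (nearSphere N R) (𝓝[<] R) :=
    tendsto_comap
  constructor
  · have hlim : Tendsto (fun x : EuclideanSpace ℝ (Fin N) =>
        C * (R ^ 2 - ‖x‖ ^ 2) * (2 * Real.pi) / ρ) (nearSphere N R) (𝓝 0) := by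
      have h1 : Tendsto (fun r => C * (R ^ 2 - r ^ 2) * (2 * Real.pi) / ρ) (𝓝[<] R)
          (𝓝 (C * (R ^ 2 - R ^ 2) * (2 * Real.pi) / ρ)) :=
        (Continuous.tendsto (by fun_prop) R).mono_left nhdsWithin_le_nhds
      rw [sub_self, mul_zero, zero_mul, zero_div] at h1
      exact h1.comp hnear
    refine squeeze_zero_norm' ?_ hlim
    filter_upwards [hnear.eventually (Ioo_mem_nhdsLT hρR)] with x hx
    have hx0 : 0 < ‖x‖ := hρ.trans hx.1
    have hxe : ‖x‖ • (‖x‖⁻¹ • x) = x := by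
      rw [smul_smul, mul_inv_cancel₀ hx0.ne', one_smul]
    have hK0 : 0 ≤ C * (R ^ 2 - ‖x‖ ^ 2) * (2 * Real.pi) :=
      mul_nonneg (mul_nonneg hC0 (by nlinarith [hx.2])) Real.two_pi_pos.le
    refine norm_tangentialGradient_le (norm_pos_iff.1 hx0) (by positivity) fun f hf hef => ?_
    have h1 := hs.fderiv_tangent_le hρ hC0 hC (norm_smul_inv_norm (norm_pos_iff.1 hx0)) hf hef
      hx.1.le hx.2
    simp only [RCLike.ofReal_real_eq_id, id_eq] at h1
    rw [hxe, map_smul, smul_eq_mul] at h1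
    rw [le_div_iff₀ hρ]
    rcases le_or_gt (fderiv ℝ u x f) 0 with h2 | h2
    · nlinarith
    · nlinarith [hx.1]
  · obtain ⟨ρ₁, M, κ, hρ₁R, hκ, hrad⟩ := hs.exists_le_fderiv_radial hg hρ hρR hn hC0 hC
    have hlim : Tendsto (fun x => κ * (u x - M)) (nearSphere N R) atTop :=
      (tendsto_atTop_add_const_right _ (-M) hu.blowUp).const_mul_atTop hκ
    refine tendsto_atTop_mono' _ ?_ hlim
    filter_upwards [hnear.eventually (Ioo_mem_nhdsLT hρR),
      hnear.eventually (Ioo_mem_nhdsLT hρ₁R), hu.blowUp.eventually (eventually_ge_atTop M)]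
      with x hx hx1 hxM
    have hx0 : 0 < ‖x‖ := hρ.trans hx.1
    have hxe : ‖x‖ • (‖x‖⁻¹ • x) = x := by
      rw [smul_smul, mul_inv_cancel₀ hx0.ne', one_smul]
    have h1 := hrad (‖x‖⁻¹ • x) ‖x‖ (norm_smul_inv_norm (norm_pos_iff.1 hx0)) hx1.1 hx1.2
      (by rwa [hxe])
    rw [hxe] at h1
    rw [radialDeriv_eq_fderiv]
    exact h1
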